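/- A seller has $k$ identical items. Buyers $1,\dots,n$ ($n\ge k$) arrive in this order; buyer $i$ wants one item and has valuation $X_i\sim\mathcal D_i$, where $\mathcal D_1,\dots,\mathcal D_n$ are continuous probability distributions on $[0,\infty)$ with finite mean, unknown to the seller. The seller knows only one sample $Y_i\sim\mathcal D_i$ from each distribution, and $X_1,\dots,X_n,Y_1,\dots,Y_n$ are independent. A (randomized) static pricing strategy chooses a random price $P$ whose distribution depends, in an arbitrary measurable way, on $n$ and on $(Y_1,\dots,Y_n)$, and which is independent of $X_1,\dots,X_n$ given the samples. Each arriving buyer with $X_i>P$ then receives an item, as long as items remain, and $\mathrm{ALG}$ is the sum of the valuations of the buyers who receive an item. The strategy achieves competitive ratio $c$ for $k$ items if $\mathbb E[\mathrm{ALG}]\ge c\cdot\mathbb E\big[\sum_{i=1}^k X^i\big]$ for all $n\ge k$ and all such $\mathcal D_1,\dots,\mathcal D_n$, where $X^i$ is the $i$-th largest of $X_1,\dots,X_n$. Then: (1) For every fixed $\varepsilon\in(0,2]$ there is $k_0$ such that for every $k\ge k_0$ no static pricing strategy achieves competitive ratio $$1-\sqrt{\frac{(2-\varepsilon)\log k}{k}}$$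 for $k$ items. (2) Hence the ratio $1-\sqrt{2\log k/k}$ cannot be improved by more than $o\big(\sqrt{\log k/k}\big)$: there is a function $\delta$ with $\delta(k)=o\big(\sqrt{\log k/k}\big)$ as $k\to\infty$ such that, for every $k\ge1$, every competitive ratio $c$ achieved by a static pricing strategy for $k$ items satisfies $$c\le 1-\sqrt{\frac{2\log k}{k}}+\delta(k).$$ -/

import Mathlib

open MeasureTheory ProbabilityTheory Filter Asymptotics

noncomputable section

/-- The law of the valuation of one buyer: a probability distribution on the nonnegative reals that
is continuous (it has a density with respect to Lebesgue measure) and has finite mean. -/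
structure IsValuationLaw (μ : Measure ℝ) : Prop where
  isProbabilityMeasure : IsProbabilityMeasure μ
  nonneg : μ (Set.Iio 0) = 0
  continuous : μ ≪ volume
  integrable : Integrable (fun t : ℝ => t) μ

/-- `largest x j` is the `(j + 1)`-st largest of the numbers `x 0, …, x (n - 1)`, counted with
multiplicity, and `0` if there are not that many. (`Tuple.sort x` sorts `x` increasingly.) -/
def largest {n : ℕ} (x : Fin n → ℝ) (j : ℕ) : ℝ :=
  if h : j < n then x (Tuple.sort x (Fin.rev ⟨j, h⟩)) else 0

/-- The value obtained by the prophet: the sum of the `k` largest valuations. -/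
def prophetValue {n : ℕ} (k : ℕ) (x : Fin n → ℝ) : ℝ :=
  ∑ j ∈ Finset.range k, largest x j

/-- Buyer `i` gets an item at the static price `p`, when `k` items are for sale and the buyers
arrive in the order `0, …, n - 1`: the valuation of `i` exceeds the price, and an item is left,
that is, fewer than `k` earlier buyers had a valuation above the price. -/
def Sold {n : ℕ} (k : ℕ) (p : EReal) (x : Fin n → ℝ) (i : Fin n) : Prop :=
  p < (x i : EReal) ∧ (Finset.univ.filter fun j : Fin n => j < i ∧ p < (x j : EReal)).card < k

/-- The value obtained by selling `k` items at the static price `p`: the sum of the valuations of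
the buyers that get an item. -/
def algValue {n : ℕ} (k : ℕ) (p : EReal) (x : Fin n → ℝ) : ℝ :=
  open Classical in ∑ i, if Sold k p x i then x i else 0

/-- A (randomized) static pricing strategy with access to one sample per buyer: for each number `n`
of buyers it maps the samples `y 0, …, y (n - 1)` measurably to the probability distribution of a
price. The price may be any extended real number; at the price `⊤` nothing is ever sold. -/
structure StaticPricingStrategy where
  price : (n : ℕ) → Kernel (Fin n → ℝ) EReal
  isMarkovKernel : ∀ n, IsMarkovKernel (price n)

namespace StaticPricingStrategy

/-- The joint law of `((Y, P), X)`: the samples `Y` and the valuations `X` are independent, both with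
independent coordinates of laws `D 0, …, D (n - 1)`, and the price `P` is drawn, given `Y`,
independently of `X`. -/
def jointLaw (A : StaticPricingStrategy) {n : ℕ} (D : Fin n → Measure ℝ) :
    Measure (((Fin n → ℝ) × EReal) × (Fin n → ℝ)) :=
  ((Measure.pi D).compProd (A.price n)).prod (Measure.pi D)

/-- The strategy has competitive ratio (at least) `c` for `k` items: on every instance with `n ≥ k`
buyers, its expected value is at least `c` times that of the prophet. -/
def IsCompetitive (A : StaticPricingStrategy) (k : ℕ) (c : ℝ) : Prop :=
  ∀ (n : ℕ), k ≤ n → ∀ D : Fin n → Measure ℝ, (∀ i, IsValuationLaw (D i)) →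
    c * ∫ x, prophetValue k x ∂(Measure.pi D) ≤ ∫ ω, algValue k ω.1.2 ω.2 ∂(A.jointLaw D)

end StaticPricingStrategy

end

/-! The samples cannot separate two demand levels that differ by a factor `1 + r` with `r` of order
`√(log k / k)`, while a price that is right for one level is costly at the other. The instance has
`k ^ 2` bulk buyers, each worth about `k` with probability `s` and almost nothing otherwise,
followed by one buyer worth about `k * V`. Here `V` is slightly below `k`: `V = k * d` with `d = k ^
(-ε / 16)`. The values around `k` are spread over a unit interval, so that a price there can ration
demand.

At `s = 1 / k` the mean bulk demand at price `k` is `k`. A price whose mean demand falls short of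
`k` by about `2 * k * r` loses about `2 * k * r` sales, more than the allowed `τ * k` once `2 * b >
a`, where `r = b * √(log k / k)` and `τ = a * √(log k / k)`. Hence a competitive strategy uses a
lower price ("low") with probability `h` bounded below (`integral_revenueBound_le_of_notMem`).

At `s = (1 + r) / k` two changes of measure, each of relative size `r`, expose the last buyer. The
samples look like those of `1 / k`, which gives a low price (`tilt_up`). The valuations look like
those of `(1 + 2 * r) / k`, where a low price sells out before the last buyer (`tilt_down`,
`prob_sold_out`). Each costs a factor of about `exp (-k * r ^ 2 / 2)`, so both together cost about
`exp (-k * r ^ 2) = k ^ (-b ^ 2)`; one shift of size `2 * r` would cost its square. This equal split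
between samples and valuations is what produces the constant 2.

The loss on the last buyer, in units of `k`, is thus about `V * k ^ (-b ^ 2)`. For `b ^ 2 = 1 / 2 -
ε / 8` this is `√k` times a positive power of `k`, up to a factor `exp (O(√(log k)))`, whereas the
allowed loss is `O(√(k * log k))`. Since `a ^ 2 = 2 - ε < 4 * b ^ 2`, both constraints cannot hold
(`exists_low_price_prob`, `eventually_not_isCompetitive`). The second claim follows by letting `ε`
tend to 0. -/

/-! ### The prophet's value as a maximum over sets of `k` buyers -/

section Prophet

variable {n k : ℕ}

/-- The indices of the `k` largest coordinates. -/
noncomputable def topIndices (k : ℕ) (x : Fin n → ℝ) : Finset (Fin n) :=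
  (Finset.univ.filter fun j : Fin n => (j : ℕ) < k).map
    ((Fin.revPerm.trans (Tuple.sort x)).toEmbedding)

lemma card_topIndices (hk : k ≤ n) (x : Fin n → ℝ) : (topIndices k x).card = k := by
  rw [topIndices, Finset.card_map, Fin.card_filter_val_lt, min_eq_right hk]

lemma prophetValue_eq_sum_topIndices (hk : k ≤ n) (x : Fin n → ℝ) :
    prophetValue k x = ∑ i ∈ topIndices k x, x i := by
  rw [prophetValue, topIndices, Finset.sum_map]
  symm
  refine Finset.sum_bij (fun j _ => (j : ℕ)) ?_ ?_ ?_ ?_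
  · simp
  · intro a _ b _ h
    exact Fin.ext h
  · intro b hb
    have hb' : b < k := Finset.mem_range.1 hb
    exact ⟨⟨b, hb'.trans_le hk⟩, by simpa using hb', rfl⟩
  · intro j _
    simp [largest]

/-- Exchange argument with the `k`-th largest value `t` as threshold: after subtracting `t`, terms
inside the top set are nonnegative and terms outside it nonpositive, and both sets have `k`
elements. -/
lemma sum_le_prophetValue (hk : k ≤ n) (x : Fin n → ℝ) {S : Finset (Fin n)} (hS : S.card = k) :
    ∑ i ∈ S, x i ≤ prophetValue k x := by
  rcases Nat.eq_zero_or_pos k with rfl | hk0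
  · rw [Finset.card_eq_zero] at hS
    simp [hS, prophetValue]
  rw [prophetValue_eq_sum_topIndices hk]
  set T := topIndices k x with hT
  set t : ℝ := x (Tuple.sort x (Fin.rev ⟨k - 1, by omega⟩)) with ht
  have hmono : Monotone (x ∘ Tuple.sort x) := Tuple.monotone_sort x
  have hmem : ∀ i : Fin n, i ∈ T ↔ ((Fin.rev ((Tuple.sort x).symm i) : Fin n) : ℕ) < k := by
    intro i
    simp only [hT, topIndices, Finset.mem_map, Finset.mem_filter, Finset.mem_univ, true_and]
    constructor
    · rintro ⟨j, hj, rfl⟩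
      simpa using hj
    · intro h
      exact ⟨_, h, by simp⟩
  have hin : ∀ i ∈ T, t ≤ x i := by
    intro i hi
    have h := (hmem i).1 hi
    have := hmono (a := Fin.rev ⟨k - 1, by omega⟩) (b := (Tuple.sort x).symm i) (by
      rw [Fin.le_def, Fin.val_rev]
      rw [Fin.val_rev] at h
      simp only
      omega)
    simpa using this
  have hout : ∀ i, i ∉ T → x i ≤ t := by
    intro i hi
    have h := mt (hmem i).2 hi
    have := hmono (a := (Tuple.sort x).symm i) (b := Fin.rev ⟨k - 1, by omega⟩) (by
      rw [Fin.le_def, Fin.val_rev]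
      rw [Fin.val_rev] at h
      simp only
      omega)
    simpa using this
  have h1 : ∑ i ∈ S, (x i - t) ≤ ∑ i ∈ S ∩ T, (x i - t) := by
    rw [← Finset.sum_inter_add_sum_sdiff S T]
    have : ∑ i ∈ S \ T, (x i - t) ≤ 0 := Finset.sum_nonpos fun i hi => by
      linarith [hout i (Finset.mem_sdiff.1 hi).2]
    linarith
  have h2 : ∑ i ∈ S ∩ T, (x i - t) ≤ ∑ i ∈ T, (x i - t) :=
    Finset.sum_le_sum_of_subset_of_nonneg Finset.inter_subset_right fun i hi _ => by
      linarith [hin i hi]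
  have h3 := h1.trans h2
  rw [Finset.sum_sub_distrib, Finset.sum_sub_distrib, Finset.sum_const, Finset.sum_const, hS,
    hT, card_topIndices hk] at h3
  linarith

lemma sum_le_prophetValue_of_nonneg (hk : k ≤ n) {x : Fin n → ℝ} (hx : ∀ i, 0 ≤ x i)
    {S : Finset (Fin n)} (hS : S.card ≤ k) : ∑ i ∈ S, x i ≤ prophetValue k x := by
  obtain ⟨T, hST, hT⟩ := Finset.exists_superset_card_eq hS (by simpa using hk)
  exact (Finset.sum_le_sum_of_subset_of_nonneg hST fun i _ _ => hx i).trans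
    (sum_le_prophetValue hk x hT)

lemma prophetValue_eq_sup' (hk : k ≤ n) (x : Fin n → ℝ) :
    prophetValue k x = ((Finset.univ : Finset (Fin n)).powersetCard k).sup'
      (Finset.powersetCard_nonempty.2 (by simpa using hk)) (fun S => ∑ i ∈ S, x i) := by
  apply le_antisymm
  · rw [prophetValue_eq_sum_topIndices hk]
    exact Finset.le_sup' (fun S => ∑ i ∈ S, x i)
      (Finset.mem_powersetCard.2 ⟨Finset.subset_univ _, card_topIndices hk x⟩)
  · exact Finset.sup'_le _ _ fun S hS => sum_le_prophetValue hk x (Finset.mem_powersetCard.1 hS).2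

lemma measurable_prophetValue (hk : k ≤ n) :
    Measurable (fun x : Fin n → ℝ => prophetValue k x) := by
  have : (fun x : Fin n → ℝ => prophetValue k x) =
      ((Finset.univ : Finset (Fin n)).powersetCard k).sup'
        (Finset.powersetCard_nonempty.2 (by simpa using hk)) (fun S x => ∑ i ∈ S, x i) := by
    ext x
    rw [prophetValue_eq_sup' hk, Finset.sup'_apply]
  rw [this]
  exact Finset.measurable_sup' _ fun S _ => by fun_prop

lemma integrable_prophetValue (hk : k ≤ n) (D : Fin n → Measure ℝ)
    (hD : ∀ i, IsValuationLaw (D i)) :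
    Integrable (fun x => prophetValue k x) (Measure.pi D) := by
  have := fun i => (hD i).isProbabilityMeasure
  have hint : Integrable (fun x : Fin n → ℝ => ∑ i, |x i|) (Measure.pi D) :=
    integrable_finsetSum _ fun i _ =>
      (integrable_comp_eval (μ := D) (i := i) (f := fun t : ℝ => |t|) (hD i).integrable.abs)
  refine hint.mono' (measurable_prophetValue hk).aestronglyMeasurable (ae_of_all _ fun x => ?_)
  rw [prophetValue_eq_sum_topIndices hk, Real.norm_eq_abs]
  exact (Finset.abs_sum_le_sum_abs _ _).trans
    (Finset.sum_le_sum_of_subset_of_nonneg (Finset.subset_univ _) fun i _ _ => abs_nonneg _)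

end Prophet

/-! ### Pathwise bounds in terms of the bulk demand -/

section Demand

variable {n k : ℕ}

open Classical in
/-- The number of buyers, apart from the last one, whose valuation lies in `A`. -/
noncomputable def countIn (A : Set ℝ) (x : Fin (n + 1) → ℝ) : ℕ :=
  (Finset.univ.filter fun i : Fin n => x i.castSucc ∈ A).card

lemma countIn_le (A : Set ℝ) (x : Fin (n + 1) → ℝ) : countIn A x ≤ n :=
  (Finset.card_le_univ _).trans (by simp)

lemma countIn_eq_sum (A : Set ℝ) (x : Fin (n + 1) → ℝ) :
    (countIn A x : ℝ) = ∑ i : Fin n, A.indicator (fun _ => (1 : ℝ)) (x i.castSucc) := by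
  classical
  simp only [countIn, Finset.card_filter, Set.indicator_apply]
  push_cast
  exact Finset.sum_congr rfl fun i _ => by congr

/-- The valuations above the price `p`. -/
abbrev above (p : EReal) : Set ℝ := {t : ℝ | p < (t : EReal)}

/-- The last buyer in `S` finds all the others ahead with valuations above the price, and there are
fewer than `k` of those. -/
lemma card_le_of_forall_sold (p : EReal) (x : Fin n → ℝ) (S : Finset (Fin n))
    (hS : ∀ i ∈ S, Sold k p x i) : S.card ≤ k := by
  classical
  rcases S.eq_empty_or_nonempty with rfl | hne
  · simp
  have hm := S.max'_mem hne
  have h := (hS _ hm).2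
  have hsub : S.erase (S.max' hne) ⊆
      Finset.univ.filter fun j : Fin n => j < S.max' hne ∧ p < (x j : EReal) := by
    intro j hj
    rw [Finset.mem_erase] at hj
    simp only [Finset.mem_filter, Finset.mem_univ, true_and]
    exact ⟨lt_of_le_of_ne (S.le_max' j hj.2) hj.1, (hS j hj.2).1⟩
  have h2 := Finset.card_le_card hsub
  rw [Finset.card_erase_of_mem hm] at h2
  have h3 : (Finset.univ.filter fun j : Fin n => j < S.max' hne ∧ p < (x j : EReal)).card < k := by
    convert h
  omega

lemma countIn_above_lt_of_sold_last {p : EReal} {x : Fin (n + 1) → ℝ}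
    (h : Sold k p x (Fin.last n)) : countIn (above p) x < k := by
  classical
  refine lt_of_le_of_lt ?_ h.2
  rw [countIn, ← Finset.card_map Fin.castSuccEmb]
  refine Finset.card_le_card fun j hj => ?_
  simp only [Finset.mem_map, Finset.mem_filter, Finset.mem_univ, true_and] at hj ⊢
  obtain ⟨i, hi, rfl⟩ := hj
  exact ⟨Fin.castSucc_lt_last i, hi⟩

/-- Bulk sales are limited both by stock and by demand, and the last buyer can be served only if the
bulk demand leaves an item. -/
lemma algValue_le {B B' : ℝ} (p : EReal) {x : Fin (n + 1) → ℝ} (hB : 0 ≤ B) (hB' : 0 ≤ B')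
    (hx : ∀ i : Fin n, x i.castSucc ≤ B) (hx' : x (Fin.last n) ≤ B') :
    algValue k p x ≤ B * min (k : ℝ) (countIn (above p) x) +
      B' * (if countIn (above p) x < k then 1 else 0) := by
  classical
  rw [algValue, Fin.sum_univ_castSucc]
  gcongr
  · set S := Finset.univ.filter fun i : Fin n => Sold k p x i.castSucc with hS
    have h1 : (S.card : ℝ) ≤ min (k : ℝ) (countIn (above p) x) := by
      refine le_min ?_ ?_
      · have := card_le_of_forall_sold (k := k) p x (S.map Fin.castSuccEmb) (by
          intro i hi
          simp only [hS, Finset.mem_map, Finset.mem_filter, Finset.mem_univ, true_and] at hi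
          obtain ⟨j, hj, rfl⟩ := hi
          exact hj)
        rw [Finset.card_map] at this
        exact_mod_cast this
      · norm_cast
        refine Finset.card_le_card fun i hi => ?_
        simp only [hS, Finset.mem_filter, Finset.mem_univ, true_and] at hi ⊢
        exact hi.1
    calc ∑ i : Fin n, (if Sold k p x i.castSucc then x i.castSucc else 0)
        = ∑ i ∈ S, x i.castSucc := by
          rw [hS, Finset.sum_filter]
      _ ≤ ∑ i ∈ S, B := Finset.sum_le_sum fun i _ => hx i
      _ = B * S.card := by rw [Finset.sum_const, nsmul_eq_mul, mul_comm]
      _ ≤ _ := by gcongr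
  · by_cases h : Sold k p x (Fin.last n)
    · rw [if_pos h, if_pos (countIn_above_lt_of_sold_last h)]
      linarith
    · rw [if_neg h]
      split_ifs <;> simp [hB']

lemma algValue_nonneg (p : EReal) {x : Fin n → ℝ} (hx : ∀ i, 0 ≤ x i) : 0 ≤ algValue k p x :=
  Finset.sum_nonneg fun i _ => by
    split_ifs
    exacts [hx i, le_rfl]

/-- One of the `k` items is reserved for the last buyer, hence `k - 1` for the bulk. -/
lemma le_prophetValue_of_countIn {K W : ℝ} (hk1 : 1 ≤ k) (hk : k ≤ n + 1) {x : Fin (n + 1) → ℝ}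
    (hx : ∀ i, 0 ≤ x i) (hx' : W ≤ x (Fin.last n)) :
    W + K * min ((k : ℝ) - 1) (countIn (Set.Ici K) x) ≤ prophetValue k x := by
  classical
  obtain ⟨T, hT, hTc⟩ := Finset.exists_subset_card_eq
    (s := Finset.univ.filter fun i : Fin n => x i.castSucc ∈ Set.Ici K)
    (n := min (k - 1) (countIn (Set.Ici K) x)) (by
      refine (min_le_right _ _).trans (le_of_eq ?_)
      rw [countIn]
      congr!)
  have hnot : Fin.last n ∉ T.map Fin.castSuccEmb := by
    simp only [Finset.mem_map, not_exists, not_and]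
    intro i _ h
    exact (Fin.castSucc_lt_last i).ne h
  have h := sum_le_prophetValue_of_nonneg (k := k) hk hx
    (S := insert (Fin.last n) (T.map Fin.castSuccEmb)) (by
      rw [Finset.card_insert_of_notMem hnot, Finset.card_map, hTc]
      have := min_le_left (k - 1) (countIn (Set.Ici K) x)
      omega)
  rw [Finset.sum_insert hnot, Finset.sum_map] at h
  refine le_trans ?_ h
  gcongr
  have h2 : (T.card : ℝ) = min ((k : ℝ) - 1) (countIn (Set.Ici K) x) := by
    rw [hTc]
    push_cast [Nat.cast_sub hk1]
    rfl
  rw [← h2, mul_comm, ← nsmul_eq_mul, ← Finset.sum_const]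
  refine Finset.sum_le_sum fun i hi => ?_
  have := hT hi
  simp only [Finset.mem_filter, Finset.mem_univ, true_and, Set.mem_Ici] at this
  exact this

end Demand

/-! ### Densities of product measures -/

section WithDensity

/-- A product of probability laws with densities has the product density. -/
lemma pi_withDensity {ι : Type*} [Fintype ι] (μ : ι → Measure ℝ)
    [∀ i, IsProbabilityMeasure (μ i)] (f : ι → ℝ → ENNReal) (hf : ∀ i, Measurable (f i))
    [∀ i, IsProbabilityMeasure ((μ i).withDensity (f i))] :
    Measure.pi (fun i => (μ i).withDensity (f i)) =
      (Measure.pi μ).withDensity (fun x => ∏ i, f i (x i)) := by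
  refine (Measure.pi_eq fun s hs => ?_)
  have hind : iIndepFun (fun i (x : ι → ℝ) => (s i).indicator (f i) (x i)) (Measure.pi μ) :=
    iIndepFun_pi (X := fun i => (s i).indicator (f i))
      (fun i => ((hf i).indicator (hs i)).aemeasurable)
  rw [withDensity_apply _ (MeasurableSet.univ_pi hs), ← lintegral_indicator (MeasurableSet.univ_pi hs)]
  have h1 : ∀ x : ι → ℝ, (Set.univ.pi s).indicator (fun x => ∏ i, f i (x i)) x =
      ∏ i, (s i).indicator (f i) (x i) := by
    intro x
    by_cases hx : x ∈ Set.univ.pi s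
    · rw [Set.indicator_of_mem hx]
      exact Finset.prod_congr rfl fun i _ => by rw [Set.indicator_of_mem (hx i (Set.mem_univ i))]
    · rw [Set.indicator_of_notMem hx]
      simp only [Set.mem_pi, Set.mem_univ, true_implies, not_forall] at hx
      obtain ⟨i, hi⟩ := hx
      exact (Finset.prod_eq_zero (Finset.mem_univ i) (Set.indicator_of_notMem hi _)).symm
  simp_rw [h1]
  rw [lintegral_prod_eq_prod_lintegral_of_indepFun _ _ hind
    (fun i => ((hf i).indicator (hs i)).comp (measurable_pi_apply i))]
  refine Finset.prod_congr rfl fun i _ => ?_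
  rw [withDensity_apply _ (hs i), ← lintegral_indicator (hs i)]
  exact (measurePreserving_eval μ i).lintegral_comp ((hf i).indicator (hs i))

end WithDensity

/-! ### The hard instance and the first two moments of its demand -/

section Laws

/-- The uniform distribution on `[a, a + 1)`. -/
noncomputable def unitLaw (a : ℝ) : Measure ℝ := volume.restrict (Set.Ico a (a + 1))

instance (a : ℝ) : IsProbabilityMeasure (unitLaw a) :=
  ⟨by simp [unitLaw]⟩

/-- The mixture that is uniform on `[K, K + 1)` with probability `s`, on `[0, 1)` otherwise. -/
noncomputable def bulkLaw (K s : ℝ) : Measure ℝ :=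
  ENNReal.ofReal (1 - s) • unitLaw 0 + ENNReal.ofReal s • unitLaw K

variable {K W s s' : ℝ} {n : ℕ}

lemma isProbabilityMeasure_bulkLaw (h0 : 0 ≤ s) (h1 : s ≤ 1) :
    IsProbabilityMeasure (bulkLaw K s) := by
  refine ⟨?_⟩
  simp only [bulkLaw, Measure.coe_add, Measure.coe_smul, Pi.add_apply, Pi.smul_apply,
    measure_univ, smul_eq_mul, mul_one]
  rw [← ENNReal.ofReal_add (by linarith) h0]
  simp

lemma bulkLaw_real (h0 : 0 ≤ s) (h1 : s ≤ 1) (A : Set ℝ) :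
    (bulkLaw K s).real A = (1 - s) * (unitLaw 0).real A + s * (unitLaw K).real A := by
  rw [Measure.real, bulkLaw]
  simp only [Measure.coe_add, Measure.coe_smul, Pi.add_apply, Pi.smul_apply, smul_eq_mul]
  rw [ENNReal.toReal_add (by finiteness) (by finiteness), ENNReal.toReal_mul, ENNReal.toReal_mul,
    ENNReal.toReal_ofReal (by linarith), ENNReal.toReal_ofReal h0]
  rfl

lemma ae_unitLaw (a : ℝ) : ∀ᵐ t ∂(unitLaw a), a ≤ t ∧ t < a + 1 :=
  (ae_restrict_iff' measurableSet_Ico).2 (ae_of_all _ fun _ h => h)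

lemma ae_bulkLaw (s : ℝ) (hK : 0 ≤ K) : ∀ᵐ t ∂(bulkLaw K s), 0 ≤ t ∧ t ≤ K + 1 := by
  rw [bulkLaw, ae_add_measure_iff]
  constructor <;> refine Measure.ae_smul_measure ?_ _
  · filter_upwards [ae_unitLaw 0] with t ht
    constructor <;> linarith [ht.1, ht.2]
  · filter_upwards [ae_unitLaw K] with t ht
    constructor <;> linarith [ht.1, ht.2]

lemma IsValuationLaw.of_ae {μ : Measure ℝ} [IsProbabilityMeasure μ] {B : ℝ} (hac : μ ≪ volume)
    (h : ∀ᵐ t ∂μ, 0 ≤ t ∧ t ≤ B) : IsValuationLaw μ where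
  isProbabilityMeasure := inferInstance
  nonneg := by
    have : ∀ᵐ t ∂μ, t ∉ Set.Iio (0 : ℝ) := by
      filter_upwards [h] with t ht
      simpa using ht.1
    exact measure_eq_zero_iff_ae_notMem.2 this
  continuous := hac
  integrable := by
    refine Integrable.of_bound (by fun_prop) B ?_
    filter_upwards [h] with t ht
    rw [Real.norm_eq_abs, abs_of_nonneg ht.1]
    exact ht.2

lemma unitLaw_absolutelyContinuous (a : ℝ) : unitLaw a ≪ volume :=
  Measure.absolutelyContinuous_of_le Measure.restrict_le_self

lemma isValuationLaw_unitLaw {a : ℝ} (ha : 0 ≤ a) : IsValuationLaw (unitLaw a) :=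
  .of_ae (B := a + 1) (unitLaw_absolutelyContinuous a) (by
    filter_upwards [ae_unitLaw a] with t ht
    exact ⟨ha.trans ht.1, ht.2.le⟩)

lemma isValuationLaw_bulkLaw (hK : 0 ≤ K) (h0 : 0 ≤ s) (h1 : s ≤ 1) :
    IsValuationLaw (bulkLaw K s) := by
  have := isProbabilityMeasure_bulkLaw (K := K) h0 h1
  refine .of_ae ?_ (ae_bulkLaw s hK)
  exact Measure.AbsolutelyContinuous.add_left
    ((unitLaw_absolutelyContinuous 0).smul_left _) ((unitLaw_absolutelyContinuous K).smul_left _)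

/-- The hard instance: `n` buyers whose valuation is about `K` with probability `s` and negligible
otherwise, followed by a buyer whose valuation is about `W`. -/
noncomputable def hardLaw (n : ℕ) (K W s : ℝ) (i : Fin (n + 1)) : Measure ℝ :=
  if i = Fin.last n then unitLaw W else bulkLaw K s

@[simp] lemma hardLaw_last : hardLaw n K W s (Fin.last n) = unitLaw W := by simp [hardLaw]

@[simp] lemma hardLaw_castSucc (i : Fin n) : hardLaw n K W s i.castSucc = bulkLaw K s := by
  simp [hardLaw, (Fin.castSucc_lt_last i).ne]

lemma isProbabilityMeasure_hardLaw (h0 : 0 ≤ s) (h1 : s ≤ 1) (i : Fin (n + 1)) :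
    IsProbabilityMeasure (hardLaw n K W s i) := by
  rw [hardLaw]
  split_ifs
  exacts [inferInstance, isProbabilityMeasure_bulkLaw h0 h1]

lemma isValuationLaw_hardLaw (hK : 0 ≤ K) (hW : 0 ≤ W) (h0 : 0 ≤ s) (h1 : s ≤ 1)
    (i : Fin (n + 1)) : IsValuationLaw (hardLaw n K W s i) := by
  rw [hardLaw]
  split_ifs
  exacts [isValuationLaw_unitLaw hW, isValuationLaw_bulkLaw hK h0 h1]

/-- The law of the whole valuation profile in the hard instance. -/
noncomputable abbrev hardPi (n : ℕ) (K W s : ℝ) : Measure (Fin (n + 1) → ℝ) :=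
  Measure.pi (hardLaw n K W s)

lemma isProbabilityMeasure_hardPi (h0 : 0 ≤ s) (h1 : s ≤ 1) :
    IsProbabilityMeasure (hardPi n K W s) := by
  have := isProbabilityMeasure_hardLaw (n := n) (K := K) (W := W) h0 h1
  infer_instance

lemma ae_hardPi (hK : 0 ≤ K) (h0 : 0 ≤ s) (h1 : s ≤ 1) :
    ∀ᵐ x ∂(hardPi n K W s), (∀ i : Fin n, 0 ≤ x i.castSucc ∧ x i.castSucc ≤ K + 1) ∧
      W ≤ x (Fin.last n) ∧ x (Fin.last n) ≤ W + 1 := by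
  have := isProbabilityMeasure_hardLaw (n := n) (K := K) (W := W) h0 h1
  rw [Filter.eventually_and, eventually_all]
  constructor
  · intro i
    refine (Measure.tendsto_eval_ae_ae (μ := hardLaw n K W s) (i := i.castSucc)).eventually
      (p := fun t => 0 ≤ t ∧ t ≤ K + 1) ?_
    rw [hardLaw_castSucc]
    exact ae_bulkLaw s hK
  · refine (Measure.tendsto_eval_ae_ae (μ := hardLaw n K W s) (i := Fin.last n)).eventually
      (p := fun t => W ≤ t ∧ t ≤ W + 1) ?_
    rw [hardLaw_last]
    filter_upwards [ae_unitLaw W] with t ht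
    exact ⟨ht.1, ht.2.le⟩

lemma measurable_countIn {A : Set ℝ} (hA : MeasurableSet A) :
    Measurable (fun x : Fin (n + 1) → ℝ => (countIn A x : ℝ)) := by
  simp_rw [countIn_eq_sum]
  exact Finset.measurable_sum _ fun i _ =>
    (measurable_const.indicator hA).comp (measurable_pi_apply _)

lemma memLp_countIn (h0 : 0 ≤ s) (h1 : s ≤ 1) {A : Set ℝ} (hA : MeasurableSet A) :
    MemLp (fun x : Fin (n + 1) → ℝ => (countIn A x : ℝ)) 2 (hardPi n K W s) := by
  have := isProbabilityMeasure_hardPi (n := n) (K := K) (W := W) h0 h1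
  refine MemLp.of_bound (measurable_countIn hA).aestronglyMeasurable n (ae_of_all _ fun x => ?_)
  rw [Real.norm_eq_abs, abs_of_nonneg (by positivity)]
  exact_mod_cast countIn_le A x

lemma integral_countIn (h0 : 0 ≤ s) (h1 : s ≤ 1) {A : Set ℝ} (hA : MeasurableSet A) :
    ∫ x, (countIn A x : ℝ) ∂(hardPi n K W s) = n * (bulkLaw K s).real A := by
  have := isProbabilityMeasure_hardLaw (n := n) (K := K) (W := W) h0 h1
  have hm : Measurable (A.indicator fun _ => (1 : ℝ)) := measurable_const.indicator hA
  simp_rw [countIn_eq_sum]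
  rw [integral_finsetSum]
  · have : ∀ i : Fin n, ∫ x, A.indicator (fun _ => (1 : ℝ)) (x i.castSucc) ∂(hardPi n K W s) =
        (bulkLaw K s).real A := fun i => by
      rw [integral_comp_eval (μ := hardLaw n K W s) (i := i.castSucc) hm.aestronglyMeasurable,
        hardLaw_castSucc, integral_indicator_const _ hA, smul_eq_mul, mul_one]
    simp_rw [this]
    simp
  · intro i _
    refine integrable_comp_eval (μ := hardLaw n K W s) (i := i.castSucc) ?_
    exact (integrable_const 1).indicator hA

lemma variance_indicator_le {μ : Measure ℝ} [IsProbabilityMeasure μ] {A : Set ℝ}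
    (hA : MeasurableSet A) : Var[A.indicator fun _ => (1 : ℝ); μ] ≤ μ.real A := by
  refine (variance_le_expectation_sq (measurable_const.indicator hA).aestronglyMeasurable).trans ?_
  have : (A.indicator fun _ => (1 : ℝ)) ^ 2 = A.indicator fun _ => (1 : ℝ) := by
    ext t
    by_cases ht : t ∈ A <;> simp [ht]
  rw [this, integral_indicator_const _ hA, smul_eq_mul, mul_one]

lemma variance_countIn_le (h0 : 0 ≤ s) (h1 : s ≤ 1) {A : Set ℝ} (hA : MeasurableSet A) :
    Var[fun x : Fin (n + 1) → ℝ => (countIn A x : ℝ); hardPi n K W s] ≤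
      n * (bulkLaw K s).real A := by
  have := isProbabilityMeasure_hardLaw (n := n) (K := K) (W := W) h0 h1
  have := isProbabilityMeasure_bulkLaw (K := K) h0 h1
  have hm : MemLp (A.indicator fun _ => (1 : ℝ)) 2 (bulkLaw K s) :=
    (memLp_const 1).indicator hA
  -- The zero summand for the last buyer makes the count a sum over all coordinates of the product
  -- space.
  set X : Fin (n + 1) → ℝ → ℝ := fun i =>
    if i = Fin.last n then 0 else A.indicator fun _ => (1 : ℝ) with hX
  have hXc : ∀ i : Fin n, X i.castSucc = A.indicator fun _ => (1 : ℝ) := fun i => by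
    simp [hX, (Fin.castSucc_lt_last i).ne]
  have hXl : X (Fin.last n) = 0 := by simp [hX]
  have h : ∀ i, MemLp (X i) 2 (hardLaw n K W s i) := by
    intro i
    induction i using Fin.lastCases with
    | last => rw [hXl]; exact MemLp.zero
    | cast i => rw [hXc, hardLaw_castSucc]; exact hm
  have hsum : (fun x : Fin (n + 1) → ℝ => (countIn A x : ℝ)) = ∑ i, fun x => X i (x i) := by
    ext x
    rw [Finset.sum_apply, Fin.sum_univ_castSucc, hXl, countIn_eq_sum]
    simp [hXc]
  rw [hsum, variance_sum_pi h, Fin.sum_univ_castSucc, hXl]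
  simp only [hXc, hardLaw_castSucc, variance_zero, add_zero, Finset.sum_const, Finset.card_univ,
    Fintype.card_fin, nsmul_eq_mul]
  gcongr
  exact variance_indicator_le hA

lemma chebyshev_countIn (h0 : 0 ≤ s) (h1 : s ≤ 1) {A : Set ℝ} (hA : MeasurableSet A) {c : ℝ}
    (hc : 0 < c) : (hardPi n K W s).real
      {x | c ≤ |(countIn A x : ℝ) - n * (bulkLaw K s).real A|} ≤
        n * (bulkLaw K s).real A / c ^ 2 := by
  have := isProbabilityMeasure_hardPi (n := n) (K := K) (W := W) h0 h1
  have h := meas_ge_le_variance_div_sq (memLp_countIn (n := n) (K := K) (W := W) h0 h1 hA) hc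
  rw [integral_countIn h0 h1 hA] at h
  refine (ENNReal.toReal_le_of_le_ofReal (by positivity [variance_nonneg (fun x : Fin (n + 1) → ℝ => (countIn A x : ℝ)) (hardPi n K W s)]) h).trans ?_
  gcongr
  exact variance_countIn_le h0 h1 hA

lemma integral_sq_countIn_le (h0 : 0 ≤ s) (h1 : s ≤ 1) {A : Set ℝ} (hA : MeasurableSet A) :
    ∫ x, ((countIn A x : ℝ) - n * (bulkLaw K s).real A) ^ 2 ∂(hardPi n K W s) ≤
      n * (bulkLaw K s).real A := by
  have h := variance_countIn_le (n := n) (K := K) (W := W) h0 h1 hA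
  rwa [variance_eq_integral (measurable_countIn hA).aemeasurable, integral_countIn h0 h1 hA] at h

lemma integrable_sq_countIn (h0 : 0 ≤ s) (h1 : s ≤ 1) {A : Set ℝ} (hA : MeasurableSet A) (m : ℝ) :
    Integrable (fun x : Fin (n + 1) → ℝ => ((countIn A x : ℝ) - m) ^ 2) (hardPi n K W s) := by
  have := isProbabilityMeasure_hardPi (n := n) (K := K) (W := W) h0 h1
  exact ((memLp_countIn h0 h1 hA).sub (memLp_const m)).integrable_sq

end Laws

/-! ### Likelihood ratio between two bulk probabilities -/

section ChangeOfMeasure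

variable {K W s s' : ℝ} {n : ℕ}

/-- The density of `bulkLaw K s'` with respect to `bulkLaw K s`. -/
noncomputable def bulkRatio (K s s' t : ℝ) : ℝ :=
  if K ≤ t then s' / s else (1 - s') / (1 - s)

lemma measurable_bulkRatio : Measurable (bulkRatio K s s') :=
  Measurable.ite measurableSet_Ici measurable_const measurable_const

/-- For `K ≥ 1` the two components live on disjoint intervals, so the value reveals its component
and the ratio is constant on each. -/
lemma bulkLaw_eq_withDensity (hK : 1 ≤ K) (h0 : 0 < s) (h1 : s < 1) :
    bulkLaw K s' = (bulkLaw K s).withDensity (fun t => ENNReal.ofReal (bulkRatio K s s' t)) := by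
  have hl : (unitLaw 0).withDensity (fun t => ENNReal.ofReal (bulkRatio K s s' t)) =
      ENNReal.ofReal ((1 - s') / (1 - s)) • unitLaw 0 := by
    rw [← withDensity_const]
    refine withDensity_congr_ae ?_
    filter_upwards [ae_unitLaw 0] with t ht
    rw [bulkRatio, if_neg (by linarith [ht.2])]
  have hu : (unitLaw K).withDensity (fun t => ENNReal.ofReal (bulkRatio K s s' t)) =
      ENNReal.ofReal (s' / s) • unitLaw K := by
    rw [← withDensity_const]
    refine withDensity_congr_ae ?_
    filter_upwards [ae_unitLaw K] with t ht
    rw [bulkRatio, if_pos ht.1]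
  rw [bulkLaw, bulkLaw, withDensity_add_measure, withDensity_smul_measure,
    withDensity_smul_measure, hl, hu, smul_smul, smul_smul, ← ENNReal.ofReal_mul (by linarith),
    ← ENNReal.ofReal_mul h0.le, mul_div_cancel₀ _ (by linarith), mul_div_cancel₀ _ h0.ne']

lemma hardPi_eq_withDensity (hK : 1 ≤ K) (h0 : 0 < s) (h1 : s < 1) (h0' : 0 < s')
    (h1' : s' < 1) :
    hardPi n K W s' = (hardPi n K W s).withDensity (fun x =>
      ENNReal.ofReal ((s' / s) ^ countIn (Set.Ici K) x *
        ((1 - s') / (1 - s)) ^ (n - countIn (Set.Ici K) x))) := by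
  classical
  have := isProbabilityMeasure_hardLaw (n := n) (K := K) (W := W) h0.le h1.le
  have := isProbabilityMeasure_hardLaw (n := n) (K := K) (W := W) h0'.le h1'.le
  set f : Fin (n + 1) → ℝ → ENNReal := fun i t =>
    if i = Fin.last n then 1 else ENNReal.ofReal (bulkRatio K s s' t) with hf
  have hfl : ∀ t, f (Fin.last n) t = 1 := fun t => by simp [hf]
  have hfc : ∀ (i : Fin n) t, f i.castSucc t = ENNReal.ofReal (bulkRatio K s s' t) := fun i t => by
    simp [hf, (Fin.castSucc_lt_last i).ne]
  have hD : ∀ i, hardLaw n K W s' i = (hardLaw n K W s i).withDensity (f i) := by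
    intro i
    induction i using Fin.lastCases with
    | last =>
      rw [hardLaw_last, hardLaw_last, funext hfl]
      exact withDensity_one.symm
    | cast i =>
      rw [hardLaw_castSucc, hardLaw_castSucc, funext (hfc i)]
      exact bulkLaw_eq_withDensity hK h0 h1
  have hfm : ∀ i, Measurable (f i) := by
    intro i
    induction i using Fin.lastCases with
    | last => rw [funext hfl]; exact measurable_const
    | cast i => rw [funext (hfc i)]; exact measurable_bulkRatio.ennreal_ofReal
  have : ∀ i, IsProbabilityMeasure ((hardLaw n K W s i).withDensity (f i)) := fun i => by
    rw [← hD i]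
    infer_instance
  rw [hardPi, funext hD, pi_withDensity _ f hfm]
  congr 1
  ext x
  rw [Fin.prod_univ_castSucc, hfl, mul_one]
  simp_rw [hfc]
  have hnn : 0 ≤ (1 - s') / (1 - s) := div_nonneg (by linarith) (by linarith)
  rw [← ENNReal.ofReal_prod_of_nonneg fun i _ => by
    rw [bulkRatio]
    split_ifs
    exacts [(div_pos h0' h0).le, hnn]]
  congr 1
  simp only [bulkRatio]
  rw [Finset.prod_ite, Finset.prod_const, Finset.prod_const]
  have hc : (Finset.univ.filter fun i : Fin n => K ≤ x i.castSucc).card =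
      countIn (Set.Ici K) x := by
    rw [countIn]
    congr!
  have hc' : (Finset.univ.filter fun i : Fin n => ¬ K ≤ x i.castSucc).card =
      n - countIn (Set.Ici K) x := by
    have := Finset.card_filter_add_card_filter_not (s := (Finset.univ : Finset (Fin n)))
      (fun i : Fin n => K ≤ x i.castSucc)
    rw [hc] at this
    simp only [Finset.card_univ, Fintype.card_fin] at this
    omega
  rw [hc, hc']

/-- If the likelihood ratio is at least `c` on `G`, an event that has small probability outside `G`
keeps at least the fraction `c` of its probability when `s` is replaced by `s'`. -/
lemma integral_change_of_measure (hK : 1 ≤ K) (h0 : 0 < s) (h1 : s < 1) (h0' : 0 < s')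
    (h1' : s' < 1) {c : ℝ} (hc : 0 ≤ c) {G : Set (Fin (n + 1) → ℝ)} (hG : MeasurableSet G)
    (hcG : ∀ x ∈ G, c ≤ (s' / s) ^ countIn (Set.Ici K) x *
        ((1 - s') / (1 - s)) ^ (n - countIn (Set.Ici K) x))
    {f : (Fin (n + 1) → ℝ) → ℝ} (hf : Measurable f) (hf0 : ∀ x, 0 ≤ f x) (hf1 : ∀ x, f x ≤ 1) :
    c * (∫ x, f x ∂(hardPi n K W s) - (hardPi n K W s).real Gᶜ) ≤
      ∫ x, f x ∂(hardPi n K W s') := by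
  have := isProbabilityMeasure_hardPi (n := n) (K := K) (W := W) h0.le h1.le
  have := isProbabilityMeasure_hardPi (n := n) (K := K) (W := W) h0'.le h1'.le
  have hint : ∀ (μ : Measure (Fin (n + 1) → ℝ)) [IsProbabilityMeasure μ], Integrable f μ :=
    fun μ _ => Integrable.of_bound hf.aestronglyMeasurable 1 (ae_of_all _ fun x => by
      rw [Real.norm_eq_abs, abs_of_nonneg (hf0 x)]
      exact hf1 x)
  -- Domination of measures suffices, so the bound applies to `[0, 1]`-valued `f`, as needed for the
  -- conditional probability of a set of randomized prices.
  have hle : ENNReal.ofReal c • (hardPi n K W s).restrict G ≤ hardPi n K W s' := by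
    rw [hardPi_eq_withDensity (s := s) (s' := s') hK h0 h1 h0' h1', ← withDensity_const, ← withDensity_indicator hG]
    refine withDensity_mono (ae_of_all _ fun x => ?_)
    by_cases hx : x ∈ G
    · rw [Set.indicator_of_mem hx]
      exact ENNReal.ofReal_le_ofReal (hcG x hx)
    · rw [Set.indicator_of_notMem hx]
      exact zero_le
  have h2 := integral_mono_measure hle (ae_of_all _ hf0) (hint _)
  rw [integral_smul_measure, ENNReal.toReal_ofReal hc, smul_eq_mul] at h2
  refine le_trans (mul_le_mul_of_nonneg_left ?_ hc) h2
  rw [← integral_add_compl hG (hint (hardPi n K W s))]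
  have h3 : ∫ x in Gᶜ, f x ∂(hardPi n K W s) ≤ (hardPi n K W s).real Gᶜ := by
    calc ∫ x in Gᶜ, f x ∂(hardPi n K W s) ≤ ∫ x in Gᶜ, (1 : ℝ) ∂(hardPi n K W s) :=
          integral_mono (hint _).integrableOn (integrable_const _) hf1
      _ = _ := by simp
  linarith

end ChangeOfMeasure

/-! ### Quantitative lower bounds on the likelihood ratio -/

section LikelihoodRatio

/-- The successes contribute about `k * r - k * r ^ 2 / 2` to the logarithm and the failures about
`-k * r`, so the linear terms cancel. The deviation of `N` costs `C * √k * r`; the term `4 * r`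
absorbs the error of the failures. -/
lemma likelihood_ratio_up {k N : ℕ} {r C : ℝ} (hk : 4 ≤ k) (hr : 0 < r) (hr' : r ≤ 1 / 4)
    (hC : 0 < C) (hN : N ≤ k ^ 2) (hdev : |(N : ℝ) - k| ≤ C * √k) :
    Real.exp (-(k * r ^ 2 / 2 + C * √k * r + 4 * r)) ≤
      (((1 + r) / k) / (1 / k : ℝ)) ^ N * ((1 - (1 + r) / k) / (1 - 1 / k)) ^ (k ^ 2 - N) := by
  have hk' : (4 : ℝ) ≤ k := by exact_mod_cast hk
  have hx1 : ((1 + r) / k) / (1 / k : ℝ) = 1 + r := by field_simp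
  have hb : 0 < 1 - (1 + r) / k := by
    rw [sub_pos, div_lt_one (by linarith)]
    linarith
  have hb' : (0 : ℝ) < 1 - 1 / k := by
    rw [sub_pos, div_lt_one (by linarith)]
    linarith
  rw [hx1]
  have hx : 0 < (1 - (1 + r) / k) / (1 - 1 / k) := div_pos hb hb'
  rw [← Real.le_log_iff_exp_le (by positivity), Real.log_mul (by positivity) (by positivity),
    Real.log_pow, Real.log_pow, Nat.cast_sub hN]
  push_cast
  have h1 : r - r ^ 2 / 2 ≤ Real.log (1 + r) := by
    refine le_trans ?_ (Real.le_log_one_add_of_nonneg hr.le)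
    rw [le_div_iff₀ (by linarith)]
    nlinarith [pow_pos hr 3]
  have h2 : -(r / (k - (1 + r))) ≤ Real.log ((1 - (1 + r) / k) / (1 - 1 / k)) := by
    refine le_trans (le_of_eq ?_) (Real.one_sub_inv_le_log_of_pos hx)
    have : (k : ℝ) - (1 + r) ≠ 0 := by linarith
    have : (k : ℝ) - 1 ≠ 0 := by linarith
    field_simp
    ring
  have hNk : (N : ℝ) ≤ (k : ℝ) ^ 2 := by exact_mod_cast hN
  have h3 : (k : ℝ) - C * √k ≤ N := by linarith [(abs_le.1 hdev).1]
  have h4 : (k : ℝ) * r - k * r ^ 2 / 2 - C * √k * r ≤ N * Real.log (1 + r) := by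
    have e1 : (N : ℝ) * (r - r ^ 2 / 2) ≤ N * Real.log (1 + r) := by gcongr
    have e2 : ((k : ℝ) - C * √k) * (r - r ^ 2 / 2) ≤ N * (r - r ^ 2 / 2) := by
      gcongr
      nlinarith
    have e3 : 0 ≤ C * √k * r ^ 2 := by positivity
    nlinarith
  have h5 : -(k * r + 4 * r) ≤
      ((k : ℝ) ^ 2 - N) * Real.log ((1 - (1 + r) / k) / (1 - 1 / k)) := by
    have e0 : 0 < r / (k - (1 + r)) := div_pos hr (by linarith)
    have e1 : ((k : ℝ) ^ 2 - N) * -(r / (k - (1 + r))) ≤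
        ((k : ℝ) ^ 2 - N) * Real.log ((1 - (1 + r) / k) / (1 - 1 / k)) :=
      mul_le_mul_of_nonneg_left h2 (by linarith)
    have e2 : ((k : ℝ) ^ 2 - N) * (r / (k - (1 + r))) ≤ (k : ℝ) ^ 2 * (r / (k - (1 + r))) := by
      gcongr
      linarith [(Nat.cast_nonneg N : (0 : ℝ) ≤ N)]
    have e3 : (k : ℝ) ^ 2 * (r / (k - (1 + r))) ≤ k * r + 4 * r := by
      rw [← mul_div_assoc, div_le_iff₀ (by linarith)]
      have e4 : 0 ≤ r * (3 * k - 4 - r * (k + 4)) := mul_nonneg hr.le (by nlinarith)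
      nlinarith
    linarith
  linarith

lemma likelihood_ratio_down {k N : ℕ} {r C : ℝ} (hk : 4 ≤ k) (hr : 0 < r) (hr' : r ≤ 1 / 4)
    (hC : 0 < C) (hCk : C * √k ≤ k) (hN : N ≤ k ^ 2)
    (hdev : |(N : ℝ) - k * (1 + 2 * r)| ≤ C * √k) :
    Real.exp (-(k * r ^ 2 / 2 + C * √k * r + 4 * r)) ≤
      (((1 + r) / k) / ((1 + 2 * r) / k : ℝ)) ^ N *
        ((1 - (1 + r) / k) / (1 - (1 + 2 * r) / k)) ^ (k ^ 2 - N) := by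
  have hk' : (4 : ℝ) ≤ k := by exact_mod_cast hk
  have hx1 : ((1 + r) / k) / ((1 + 2 * r) / k : ℝ) = ((1 + 2 * r) / (1 + r))⁻¹ := by field_simp
  have hb : 0 < 1 - (1 + r) / k := by
    rw [sub_pos, div_lt_one (by linarith)]
    linarith
  have hb' : (0 : ℝ) < 1 - (1 + 2 * r) / k := by
    rw [sub_pos, div_lt_one (by linarith)]
    linarith
  rw [hx1]
  set x := (1 + 2 * r) / (1 + r) with hxdef
  have hx0 : 0 < x := by positivity
  have hx : 0 < (1 - (1 + r) / k) / (1 - (1 + 2 * r) / k) := div_pos hb hb'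
  rw [← Real.le_log_iff_exp_le (by positivity), Real.log_mul (by positivity) (by positivity),
    Real.log_pow, Real.log_pow, Nat.cast_sub hN, Real.log_inv]
  push_cast
  have hx1' : 1 ≤ x := by
    rw [hxdef, le_div_iff₀ (by linarith)]
    linarith
  have hlog0 : 0 ≤ Real.log x := Real.log_nonneg hx1'
  -- The bound `log x ≤ sinh (log x) = (x - 1 / x) / 2` is exact to second order. The cruder `log x
  -- ≤ x - 1` would double the coefficient of `k * r ^ 2`.
  have h1 : Real.log x ≤ (2 * r + 3 * r ^ 2) / (2 * (1 + r) * (1 + 2 * r)) := by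
    refine (Real.self_le_sinh_iff.2 hlog0).trans (le_of_eq ?_)
    rw [Real.sinh_log hx0, hxdef]
    field_simp
    ring
  have h1' : Real.log x ≤ r := by
    refine h1.trans ?_
    rw [div_le_iff₀ (by positivity)]
    nlinarith [pow_pos hr 3, pow_pos hr 2]
  have h2 : r / k ≤ Real.log ((1 - (1 + r) / k) / (1 - (1 + 2 * r) / k)) := by
    refine le_trans ?_ (Real.one_sub_inv_le_log_of_pos hx)
    have e1 : (0 : ℝ) < k - (1 + r) := by linarith
    have : 1 - ((1 - (1 + r) / k) / (1 - (1 + 2 * r) / k))⁻¹ = r / (k - (1 + r)) := by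
      have : (k : ℝ) - (1 + 2 * r) ≠ 0 := by linarith
      field_simp
      ring
    rw [this]
    gcongr
    linarith
  have hNk : (N : ℝ) ≤ (k : ℝ) ^ 2 := by exact_mod_cast hN
  have h3 : (N : ℝ) ≤ k * (1 + 2 * r) + C * √k := by linarith [(abs_le.1 hdev).2]
  have h4 : (N : ℝ) * Real.log x ≤ k * r + k * r ^ 2 / 2 + C * √k * r := by
    have e1 : (N : ℝ) * Real.log x ≤ (k * (1 + 2 * r) + C * √k) * Real.log x := by gcongr
    have e2 : (k : ℝ) * (1 + 2 * r) * Real.log x ≤ k * (r + r ^ 2 / 2) := by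
      rw [mul_assoc]
      gcongr
      calc (1 + 2 * r) * Real.log x
          ≤ (1 + 2 * r) * ((2 * r + 3 * r ^ 2) / (2 * (1 + r) * (1 + 2 * r))) := by gcongr
        _ = (2 * r + 3 * r ^ 2) / (2 * (1 + r)) := by field_simp
        _ ≤ r + r ^ 2 / 2 := by
          rw [div_le_iff₀ (by positivity)]
          nlinarith [pow_pos hr 3]
    have e3 : C * √k * Real.log x ≤ C * √k * r := by gcongr
    nlinarith
  have h5 : k * r - 3 * r ≤
      ((k : ℝ) ^ 2 - N) * Real.log ((1 - (1 + r) / k) / (1 - (1 + 2 * r) / k)) := by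
    have e1 : ((k : ℝ) ^ 2 - N) * (r / k) ≤
        ((k : ℝ) ^ 2 - N) * Real.log ((1 - (1 + r) / k) / (1 - (1 + 2 * r) / k)) :=
      mul_le_mul_of_nonneg_left h2 (by linarith)
    -- Here `N ≤ 3 * k`, from `r ≤ 1 / 4` and `C * √k ≤ k`.
    have e2 : (k ^ 2 - 3 * k : ℝ) * (r / k) ≤ ((k : ℝ) ^ 2 - N) * (r / k) := by
      gcongr
      nlinarith
    have e3 : (k ^ 2 - 3 * k : ℝ) * (r / k) = k * r - 3 * r := by field_simp
    linarith
  linarith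

end LikelihoodRatio

/-! ### Expected values of the prophet and of the strategy -/

section Values

variable {K W s : ℝ} {n k : ℕ}

lemma unitLaw_zero_real_Ici (hK : 1 ≤ K) : (unitLaw 0).real (Set.Ici K) = 0 := by
  rw [Measure.real, ENNReal.toReal_eq_zero_iff]
  left
  rw [measure_eq_zero_iff_ae_notMem]
  filter_upwards [ae_unitLaw 0] with t ht
  simp only [Set.mem_Ici, not_le]
  linarith [ht.2]

lemma unitLaw_real_of_subset {A : Set ℝ} (hA : Set.Ici K ⊆ A) : (unitLaw K).real A = 1 := by
  rw [Measure.real, unitLaw, Measure.restrict_apply' measurableSet_Ico,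
    Set.inter_eq_right.2 (Set.Ico_subset_Ici_self.trans hA)]
  simp

lemma bulkLaw_real_Ici (hK : 1 ≤ K) (h0 : 0 ≤ s) (h1 : s ≤ 1) :
    (bulkLaw K s).real (Set.Ici K) = s := by
  rw [bulkLaw_real h0 h1, unitLaw_zero_real_Ici hK, unitLaw_real_of_subset subset_rfl]
  ring

lemma measurableSet_above (p : EReal) : MeasurableSet (above p) :=
  measurableSet_lt measurable_const measurable_coe_real_ereal

lemma le_integral_prophetValue (hk1 : 4 ≤ k) (hk : k ≤ n + 1) (hK : 1 ≤ K) (hW : 0 ≤ W)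
    (h0 : 0 ≤ s) (h1 : s ≤ 1) (hm : (k : ℝ) ≤ n * s) (hm' : n * s ≤ 2 * k) :
    W + K * (k - 1 - 2 * √k) ≤ ∫ x, prophetValue k x ∂(hardPi n K W s) := by
  have := isProbabilityMeasure_hardPi (n := n) (K := K) (W := W) h0 h1
  have hk' : (4 : ℝ) ≤ k := by exact_mod_cast hk1
  have hsq : 0 < √(k : ℝ) := Real.sqrt_pos.2 (by linarith)
  have hss : √(k : ℝ) * √k = k := Real.mul_self_sqrt (by linarith)
  have hint := integrable_sq_countIn (n := n) (K := K) (W := W) h0 h1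
    (measurableSet_Ici (a := K)) (n * s)
  have hmom := integral_sq_countIn_le (n := n) (K := K) (W := W) h0 h1 (measurableSet_Ici (a := K))
  rw [bulkLaw_real_Ici hK h0 h1] at hmom
  have hint2 : Integrable (fun x : Fin (n + 1) → ℝ => W + K * (k - 1 - √k / 2) -
      (K / (2 * √k)) * ((countIn (Set.Ici K) x : ℝ) - n * s) ^ 2) (hardPi n K W s) :=
    (integrable_const _).sub (hint.const_mul _)
  have hmono : ∫ x, (W + K * (k - 1 - √k / 2) -
      (K / (2 * √k)) * ((countIn (Set.Ici K) x : ℝ) - n * s) ^ 2) ∂(hardPi n K W s) ≤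
        ∫ x, prophetValue k x ∂(hardPi n K W s) := by
    refine integral_mono_ae hint2 (integrable_prophetValue hk _
      (isValuationLaw_hardLaw (by linarith) hW h0 h1)) ?_
    filter_upwards [ae_hardPi (n := n) (K := K) (W := W) (by linarith) h0 h1] with x hx
    have hx0 : ∀ i, 0 ≤ x i := by
      intro i
      induction i using Fin.lastCases with
      | last => linarith [hx.2.1]
      | cast i => exact (hx.1 i).1
    refine le_trans ?_ (le_prophetValue_of_countIn (K := K) (by omega) hk hx0 hx.2.1)
    set N : ℝ := (countIn (Set.Ici K) x : ℝ)
    -- A quadratic minorant of the truncated count, by AM-GM with weight `√k`, turns the variance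
    -- bound directly into a loss of order `√k`.
    have hN : (k : ℝ) - 1 - √k / 2 - (N - n * s) ^ 2 / (2 * √k) ≤ min ((k : ℝ) - 1) N := by
      have hq : 0 ≤ (N - n * s) ^ 2 / (2 * √k) := by positivity
      refine le_min (by linarith) ?_
      have : -(N - n * s) - √k / 2 ≤ (N - n * s) ^ 2 / (2 * √k) := by
        rw [le_div_iff₀ (by positivity)]
        nlinarith [sq_nonneg (N - n * s + √k)]
      linarith
    have := mul_le_mul_of_nonneg_left hN (by linarith : 0 ≤ K)
    calc _ = W + K * ((k : ℝ) - 1 - √k / 2 - (N - n * s) ^ 2 / (2 * √k)) := by ring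
      _ ≤ _ := by linarith
  refine le_trans ?_ hmono
  rw [integral_sub (integrable_const _) (hint.const_mul _), integral_const_mul]
  simp only [integral_const, probReal_univ, smul_eq_mul, one_mul]
  have h6 : K / (2 * √k) * ∫ x, ((countIn (Set.Ici K) x : ℝ) - n * s) ^ 2 ∂(hardPi n K W s) ≤
      K / (2 * √k) * (2 * k) := by
    gcongr
    exact hmom.trans hm'
  have h7 : K / (2 * √k) * (2 * k) = K * √k := by
    field_simp
    nlinarith
  nlinarith

/-- An upper bound for the value obtained at the price `p`. -/
noncomputable def revenueBound (k : ℕ) (K W : ℝ) (p : EReal) (x : Fin (n + 1) → ℝ) : ℝ :=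
  (K + 1) * min (k : ℝ) (countIn (above p) x) +
    (W + 1) * (if countIn (above p) x < k then 1 else 0)

lemma measurable_countIn_above :
    Measurable (fun q : EReal × (Fin (n + 1) → ℝ) => countIn (above q.1) q.2) := by
  classical
  have : (fun q : EReal × (Fin (n + 1) → ℝ) => countIn (above q.1) q.2) = fun q =>
      ∑ i : Fin n, if q.1 < (q.2 i.castSucc : EReal) then 1 else 0 := by
    ext q
    rw [countIn, Finset.card_filter]
    congr!
  rw [this]
  refine Finset.measurable_sum _ fun i _ => Measurable.ite ?_ measurable_const measurable_const
  exact measurableSet_lt measurable_fst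
    (measurable_coe_real_ereal.comp ((measurable_pi_apply _).comp measurable_snd))

lemma measurable_revenueBound :
    Measurable (fun q : EReal × (Fin (n + 1) → ℝ) => revenueBound k K W q.1 q.2) := by
  have h := measurable_countIn_above (n := n)
  have h' : Measurable (fun q : EReal × (Fin (n + 1) → ℝ) => (countIn (above q.1) q.2 : ℝ)) :=
    measurable_from_top.comp h
  refine ((measurable_const.min h').const_mul _).add (Measurable.const_mul ?_ _)
  exact Measurable.ite (h (measurableSet_Iio (a := k))) measurable_const measurable_const

lemma revenueBound_nonneg (hK : 0 ≤ K) (hW : 0 ≤ W) (p : EReal) (x : Fin (n + 1) → ℝ) :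
    0 ≤ revenueBound k K W p x := by
  rw [revenueBound]
  split_ifs <;> positivity

lemma revenueBound_le (hK : 0 ≤ K) (hW : 0 ≤ W) (p : EReal) (x : Fin (n + 1) → ℝ) :
    revenueBound k K W p x ≤ (K + 1) * k + (W + 1) := by
  rw [revenueBound]
  have := min_le_left (k : ℝ) (countIn (above p) x)
  have h2 : (K + 1) * min (k : ℝ) (countIn (above p) x) ≤ (K + 1) * k := by gcongr
  split_ifs <;> linarith

lemma integrable_revenueBound (hK : 0 ≤ K) (hW : 0 ≤ W) (h0 : 0 ≤ s) (h1 : s ≤ 1) (p : EReal) :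
    Integrable (fun x => revenueBound k K W p x) (hardPi n K W s) := by
  have := isProbabilityMeasure_hardPi (n := n) (K := K) (W := W) h0 h1
  refine Integrable.of_bound
    (measurable_revenueBound.comp (f := fun x : Fin (n + 1) → ℝ => (p, x))
      (measurable_const.prodMk measurable_id)).aestronglyMeasurable
    ((K + 1) * k + (W + 1)) (ae_of_all _ fun x => ?_)
  rw [Real.norm_eq_abs, abs_of_nonneg (revenueBound_nonneg hK hW p x)]
  exact revenueBound_le hK hW p x

/-- The price is independent of the valuations given the samples, so `loss` may be charged price by
price; prices outside `S` are bounded by the trivial maximum. -/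
lemma integral_algValue_le (A : StaticPricingStrategy) (hK : 0 ≤ K) (hW : 0 ≤ W) (h0 : 0 ≤ s)
    (h1 : s ≤ 1) {S : Set EReal} (hS : MeasurableSet S) {loss : ℝ}
    (hloss : ∀ p ∈ S, ∫ x, revenueBound k K W p x ∂(hardPi n K W s) ≤
      (K + 1) * k + (W + 1) - loss) :
    ∫ ω, algValue k ω.1.2 ω.2 ∂(A.jointLaw (hardLaw n K W s)) ≤
      (K + 1) * k + (W + 1) - loss * ∫ y, (A.price (n + 1) y).real S ∂(hardPi n K W s) := by
  have := isProbabilityMeasure_hardPi (n := n) (K := K) (W := W) h0 h1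
  have := A.isMarkovKernel (n + 1)
  set ρ := (hardPi n K W s).compProd (A.price (n + 1)) with hρ
  set M := (K + 1) * k + (W + 1) with hM
  have hUm : Measurable (fun ω : ((Fin (n + 1) → ℝ) × EReal) × (Fin (n + 1) → ℝ) =>
      revenueBound k K W ω.1.2 ω.2) :=
    measurable_revenueBound.comp (f := fun ω : ((Fin (n + 1) → ℝ) × EReal) × (Fin (n + 1) → ℝ) =>
      (ω.1.2, ω.2)) ((measurable_snd.comp measurable_fst).prodMk measurable_snd)
  have hUi : Integrable (fun ω : ((Fin (n + 1) → ℝ) × EReal) × (Fin (n + 1) → ℝ) =>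
      revenueBound k K W ω.1.2 ω.2) (ρ.prod (hardPi n K W s)) := by
    refine Integrable.of_bound hUm.aestronglyMeasurable M (ae_of_all _ fun x => ?_)
    rw [Real.norm_eq_abs, abs_of_nonneg (revenueBound_nonneg hK hW _ _)]
    exact revenueBound_le hK hW _ _
  have hae : ∀ᵐ ω ∂(ρ.prod (hardPi n K W s)), (∀ i : Fin n, 0 ≤ ω.2 i.castSucc ∧
      ω.2 i.castSucc ≤ K + 1) ∧ W ≤ ω.2 (Fin.last n) ∧ ω.2 (Fin.last n) ≤ W + 1 :=
    Measure.quasiMeasurePreserving_snd.ae (ae_hardPi hK h0 h1)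
  have hSm : Measurable (S.indicator fun _ => (1 : ℝ)) := measurable_const.indicator hS
  have hSi : Integrable (fun z : (Fin (n + 1) → ℝ) × EReal => S.indicator (fun _ => (1 : ℝ)) z.2)
      ρ := by
    refine Integrable.of_bound (hSm.comp measurable_snd).aestronglyMeasurable 1
      (ae_of_all _ fun z => ?_)
    by_cases hz : z.2 ∈ S <;> simp [hz]
  have hJ : A.jointLaw (hardLaw n K W s) = ρ.prod (hardPi n K W s) := rfl
  rw [hJ]
  calc ∫ ω, algValue k ω.1.2 ω.2 ∂(ρ.prod (hardPi n K W s))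
      ≤ ∫ ω, revenueBound k K W ω.1.2 ω.2 ∂(ρ.prod (hardPi n K W s)) := by
        refine integral_mono_of_nonneg ?_ hUi ?_
        · filter_upwards [hae] with ω hω
          refine algValue_nonneg _ fun i => ?_
          induction i using Fin.lastCases with
          | last => linarith [hω.2.1]
          | cast i => exact (hω.1 i).1
        · filter_upwards [hae] with ω hω
          exact algValue_le _ (by linarith) (by linarith) (fun i => (hω.1 i).2) hω.2.2
    _ = ∫ z, ∫ x, revenueBound k K W z.2 x ∂(hardPi n K W s) ∂ρ := integral_prod _ hUi
    _ ≤ ∫ z, (M - loss * S.indicator (fun _ => (1 : ℝ)) z.2) ∂ρ := by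
        refine integral_mono hUi.integral_prod_left ((integrable_const M).sub (hSi.const_mul loss))
          fun z => ?_
        by_cases hz : z.2 ∈ S
        · simpa [hz] using hloss _ hz
        · simp only [hz, not_false_eq_true, Set.indicator_of_notMem, mul_zero, sub_zero]
          calc ∫ x, revenueBound k K W z.2 x ∂(hardPi n K W s) ≤ ∫ x, M ∂(hardPi n K W s) :=
                integral_mono (integrable_revenueBound hK hW h0 h1 _) (integrable_const _)
                  fun x => revenueBound_le hK hW _ _
            _ = M := by simp
    _ = M - loss * ∫ y, (A.price (n + 1) y).real S ∂(hardPi n K W s) := by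
        rw [integral_sub (integrable_const M) (hSi.const_mul loss), integral_const_mul, hρ,
          Measure.integral_compProd hSi]
        simp only [integral_indicator_const _ hS]
        simp

end Values

/-! ### The two competing losses -/

section LowerBound

variable {K W s : ℝ} {n k : ℕ}

/-- The prices at which, in the instance with mean demand `k` above `K`, the mean demand is at
least `k - δ`. -/
def lowPrices (k : ℕ) (K δ : ℝ) : Set EReal :=
  {p | (k : ℝ) - δ ≤ k * (unitLaw K).real (above p)}

lemma measurable_unitLaw_real_above (a : ℝ) :
    Measurable fun p : EReal => (unitLaw a).real (above p) := by
  have h : MeasurableSet {q : EReal × ℝ | q.1 < (q.2 : EReal)} :=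
    measurableSet_lt measurable_fst (measurable_coe_real_ereal.comp measurable_snd)
  exact (measurable_measure_prodMk_left h).ennreal_toReal

lemma measurableSet_lowPrices (k : ℕ) (K δ : ℝ) : MeasurableSet (lowPrices k K δ) :=
  measurableSet_le measurable_const ((measurable_unitLaw_real_above K).const_mul _)

/-- A price that excludes part of the upper component is at least `K`, hence excludes the lower
component altogether. -/
lemma unitLaw_zero_real_above (hK : 1 ≤ K) {p : EReal} (hp : (unitLaw K).real (above p) < 1) :
    (unitLaw 0).real (above p) = 0 := by
  have h : ¬ Set.Ici K ⊆ above p := fun h => hp.ne (unitLaw_real_of_subset h)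
  have hpK : (K : EReal) ≤ p := by
    by_contra! hlt
    exact h fun t ht => lt_of_lt_of_le hlt (EReal.coe_le_coe_iff.2 ht)
  refine le_antisymm (le_trans (measureReal_mono (s₂ := Set.Ici K) fun t ht => ?_)
    (unitLaw_zero_real_Ici hK).le) measureReal_nonneg
  exact EReal.coe_le_coe_iff.1 (hpK.trans (le_of_lt ht))

/-- Mean sales are at most the mean demand, even when the last buyer is granted for free. -/
lemma integral_revenueBound_le_of_notMem (hk : 4 ≤ k) {δ : ℝ} (hδ : 0 ≤ δ) (hW : 0 ≤ W)
    {p : EReal} (hp : p ∈ (lowPrices k k δ)ᶜ) :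
    ∫ x, revenueBound k k W p x ∂(hardPi (k ^ 2) k W (1 / k)) ≤
      ((k : ℝ) + 1) * k + (W + 1) - (k + 1) * δ := by
  have hk' : (4 : ℝ) ≤ k := by exact_mod_cast hk
  have h0 : (0 : ℝ) ≤ 1 / k := by positivity
  have h1 : (1 / k : ℝ) ≤ 1 := by
    rw [div_le_one (by linarith)]
    linarith
  have := isProbabilityMeasure_hardPi (n := k ^ 2) (K := k) (W := W) h0 h1
  simp only [lowPrices, Set.mem_compl_iff, Set.mem_ofPred_eq, not_le] at hp
  have hlt : (unitLaw (k : ℝ)).real (above p) < 1 := by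
    by_contra! h
    nlinarith
  have hmean : ∫ x, (countIn (above p) x : ℝ) ∂(hardPi (k ^ 2) k W (1 / k)) ≤ k - δ := by
    rw [integral_countIn h0 h1 (measurableSet_above p), bulkLaw_real h0 h1,
      unitLaw_zero_real_above (by linarith) hlt]
    push_cast
    have : (k : ℝ) ^ 2 * ((1 - 1 / k) * 0 + 1 / k * (unitLaw (k : ℝ)).real (above p)) =
        k * (unitLaw (k : ℝ)).real (above p) := by field_simp; ring
    linarith
  have hi : Integrable (fun x => (countIn (above p) x : ℝ)) (hardPi (k ^ 2) k W (1 / k)) :=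
    (memLp_countIn h0 h1 (measurableSet_above p)).integrable one_le_two
  calc ∫ x, revenueBound k k W p x ∂(hardPi (k ^ 2) k W (1 / k))
      ≤ ∫ x, (((k : ℝ) + 1) * (countIn (above p) x : ℝ) + (W + 1))
          ∂(hardPi (k ^ 2) k W (1 / k)) := by
        refine integral_mono (integrable_revenueBound (by linarith) hW h0 h1 p)
          ((hi.const_mul _).add (integrable_const _)) fun x => ?_
        rw [revenueBound]
        have e1 := min_le_right (k : ℝ) (countIn (above p) x)
        have e2 : ((k : ℝ) + 1) * min (k : ℝ) (countIn (above p) x) ≤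
            (k + 1) * (countIn (above p) x) := by gcongr
        dsimp only
        split_ifs <;> linarith
    _ = ((k : ℝ) + 1) * ∫ x, (countIn (above p) x : ℝ) ∂(hardPi (k ^ 2) k W (1 / k)) +
          (W + 1) := by
        rw [integral_add (hi.const_mul _) (integrable_const _), integral_const_mul,
          integral_const, probReal_univ, one_smul]
    _ ≤ _ := by nlinarith

lemma integral_revenueBound_le_of_prob (hK : 0 ≤ K) (hW : 0 ≤ W) (h0 : 0 ≤ s) (h1 : s ≤ 1)
    {p : EReal} {q : ℝ} (hq : q ≤ (hardPi n K W s).real {x | k ≤ countIn (above p) x}) :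
    ∫ x, revenueBound k K W p x ∂(hardPi n K W s) ≤ (K + 1) * k + (W + 1) - (W + 1) * q := by
  have := isProbabilityMeasure_hardPi (n := n) (K := K) (W := W) h0 h1
  have hE : MeasurableSet {x : Fin (n + 1) → ℝ | k ≤ countIn (above p) x} := by
    have := measurableSet_le (measurable_const (a := (k : ℝ)))
      (measurable_countIn (n := n) (measurableSet_above p))
    simpa using this
  have hi : Integrable ({x : Fin (n + 1) → ℝ | k ≤ countIn (above p) x}.indicator
      fun _ => (1 : ℝ)) (hardPi n K W s) := (integrable_const 1).indicator hE
  calc ∫ x, revenueBound k K W p x ∂(hardPi n K W s)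
      ≤ ∫ x, ((K + 1) * k + (W + 1) - (W + 1) * {x : Fin (n + 1) → ℝ |
          k ≤ countIn (above p) x}.indicator (fun _ => (1 : ℝ)) x) ∂(hardPi n K W s) := by
        refine integral_mono (integrable_revenueBound hK hW h0 h1 p)
          ((integrable_const _).sub (hi.const_mul _)) fun x => ?_
        rw [revenueBound]
        have e1 := min_le_left (k : ℝ) (countIn (above p) x)
        have e2 : (K + 1) * min (k : ℝ) (countIn (above p) x) ≤ (K + 1) * k := by gcongr
        by_cases hx : k ≤ countIn (above p) x
        · simp only [Set.mem_ofPred_eq, hx, Set.indicator_of_mem, not_lt.2 hx, if_false]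
          linarith
        · simp only [Set.mem_ofPred_eq, hx, not_false_eq_true, Set.indicator_of_notMem,
            not_le.1 hx, if_true]
          linarith
    _ = (K + 1) * k + (W + 1) - (W + 1) *
          (hardPi n K W s).real {x | k ≤ countIn (above p) x} := by
        rw [integral_sub (integrable_const _) (hi.const_mul _), integral_const_mul,
          integral_indicator_const _ hE]
        simp
    _ ≤ _ := by gcongr

/-- The event that the number of valuations above `K` is within `c` of `m`. -/
def typical (n : ℕ) (K m c : ℝ) : Set (Fin (n + 1) → ℝ) :=
  {x | |(countIn (Set.Ici K) x : ℝ) - m| ≤ c}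

lemma measurableSet_typical (n : ℕ) (K m c : ℝ) : MeasurableSet (typical n K m c) :=
  measurableSet_le (continuous_abs.measurable.comp
    ((measurable_countIn measurableSet_Ici).sub_const m)) measurable_const

lemma hardPi_real_compl_typical_le (hK : 1 ≤ K) (h0 : 0 ≤ s) (h1 : s ≤ 1) {c : ℝ} (hc : 0 < c) :
    (hardPi n K W s).real (typical n K (n * s) c)ᶜ ≤ n * s / c ^ 2 := by
  have := isProbabilityMeasure_hardPi (n := n) (K := K) (W := W) h0 h1
  have h := chebyshev_countIn (n := n) (K := K) (W := W) h0 h1 (measurableSet_Ici (a := K)) hc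
  rw [bulkLaw_real_Ici hK h0 h1] at h
  refine (measureReal_mono fun x hx => ?_).trans h
  simp only [typical, Set.mem_compl_iff, Set.mem_ofPred_eq, not_le] at hx
  exact hx.le

/-- The factor lost by the two changes of measure. -/
noncomputable def tiltFactor (k : ℕ) (r C : ℝ) : ℝ :=
  Real.exp (-(k * r ^ 2 / 2 + C * √k * r + 4 * r))

variable {r C : ℝ}

lemma tilt_up (hk : 4 ≤ k) (hr : 0 < r) (hr' : r ≤ 1 / 4) (hC : 0 < C)
    {f : (Fin (k ^ 2 + 1) → ℝ) → ℝ} (hf : Measurable f) (hf0 : ∀ x, 0 ≤ f x)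
    (hf1 : ∀ x, f x ≤ 1) :
    tiltFactor k r C * (∫ x, f x ∂(hardPi (k ^ 2) k W (1 / k)) - 2 / C ^ 2) ≤
      ∫ x, f x ∂(hardPi (k ^ 2) k W ((1 + r) / k)) := by
  have hk' : (4 : ℝ) ≤ k := by exact_mod_cast hk
  have h0 : (0 : ℝ) < 1 / k := by positivity
  have h1 : (1 / k : ℝ) < 1 := by
    rw [div_lt_one (by linarith)]
    linarith
  have h0' : (0 : ℝ) < (1 + r) / k := by positivity
  have h1' : ((1 + r) / k : ℝ) < 1 := by
    rw [div_lt_one (by linarith)]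
    linarith
  have hm : ((k ^ 2 : ℕ) : ℝ) * (1 / k) = k := by push_cast; field_simp
  have hsq : 0 < √(k : ℝ) := Real.sqrt_pos.2 (by linarith)
  have hbad := hardPi_real_compl_typical_le (n := k ^ 2) (K := k) (W := W) (by linarith) h0.le h1.le
    (mul_pos hC hsq)
  rw [hm, mul_pow, Real.sq_sqrt (by linarith)] at hbad
  have hbad' : (k : ℝ) / (C ^ 2 * k) ≤ 2 / C ^ 2 := by
    rw [div_le_div_iff₀ (by positivity) (by positivity)]
    nlinarith [sq_nonneg C, mul_nonneg (sq_nonneg C) (by linarith : (0 : ℝ) ≤ k)]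
  refine le_trans ?_ (integral_change_of_measure (n := k ^ 2) (K := k) (W := W) (by linarith)
    h0 h1 h0' h1' (Real.exp_pos _).le
    (measurableSet_typical (k ^ 2) k k (C * √k)) (fun x hx => likelihood_ratio_up hk hr hr' hC
      (countIn_le _ x) hx) hf hf0 hf1)
  exact mul_le_mul_of_nonneg_left (by linarith) (Real.exp_pos _).le

lemma tilt_down (hk : 4 ≤ k) (hr : 0 < r) (hr' : r ≤ 1 / 4) (hC : 0 < C) (hCk : C * √k ≤ k)
    {f : (Fin (k ^ 2 + 1) → ℝ) → ℝ} (hf : Measurable f) (hf0 : ∀ x, 0 ≤ f x)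
    (hf1 : ∀ x, f x ≤ 1) :
    tiltFactor k r C * (∫ x, f x ∂(hardPi (k ^ 2) k W ((1 + 2 * r) / k)) - 2 / C ^ 2) ≤
      ∫ x, f x ∂(hardPi (k ^ 2) k W ((1 + r) / k)) := by
  have hk' : (4 : ℝ) ≤ k := by exact_mod_cast hk
  have h0 : (0 : ℝ) < (1 + 2 * r) / k := by positivity
  have h1 : ((1 + 2 * r) / k : ℝ) < 1 := by
    rw [div_lt_one (by linarith)]
    linarith
  have h0' : (0 : ℝ) < (1 + r) / k := by positivity
  have h1' : ((1 + r) / k : ℝ) < 1 := by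
    rw [div_lt_one (by linarith)]
    linarith
  have hm : ((k ^ 2 : ℕ) : ℝ) * ((1 + 2 * r) / k) = k * (1 + 2 * r) := by push_cast; field_simp
  have hsq : 0 < √(k : ℝ) := Real.sqrt_pos.2 (by linarith)
  have hbad := hardPi_real_compl_typical_le (n := k ^ 2) (K := k) (W := W) (by linarith) h0.le h1.le
    (mul_pos hC hsq)
  rw [hm, mul_pow, Real.sq_sqrt (by linarith)] at hbad
  have hbad' : (k : ℝ) * (1 + 2 * r) / (C ^ 2 * k) ≤ 2 / C ^ 2 := by
    rw [div_le_div_iff₀ (by positivity) (by positivity)]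
    have : 0 ≤ (k : ℝ) * C ^ 2 * (1 - 2 * r) := mul_nonneg (by positivity) (by linarith)
    nlinarith
  refine le_trans ?_ (integral_change_of_measure (n := k ^ 2) (K := k) (W := W) (by linarith)
    h0 h1 h0' h1' (Real.exp_pos _).le
    (measurableSet_typical (k ^ 2) k (k * (1 + 2 * r)) (C * √k))
    (fun x hx => likelihood_ratio_down hk hr hr' hC hCk (countIn_le _ x) hx) hf hf0 hf1)
  exact mul_le_mul_of_nonneg_left (by linarith) (Real.exp_pos _).le

/-- The shortfall of the mean demand for which the stock runs out with probability at least `1 / 2`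
once the demand has been scaled up by `1 + 2 r`. -/
noncomputable def shortfall (k : ℕ) (r : ℝ) : ℝ := 2 * k * r - 4 * k * r ^ 2 - 2 * √k

lemma prob_sold_out_scaled (hk : 4 ≤ k) (hr : 0 < r) (hr' : r ≤ 1 / 4) {p : EReal}
    (hp : p ∈ lowPrices k k (shortfall k r)) :
    1 / 2 ≤ (hardPi (k ^ 2) k W ((1 + 2 * r) / k)).real {x | k ≤ countIn (above p) x} := by
  have hk' : (4 : ℝ) ≤ k := by exact_mod_cast hk
  have h0 : (0 : ℝ) ≤ (1 + 2 * r) / k := by positivity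
  have h1 : ((1 + 2 * r) / k : ℝ) ≤ 1 := by
    rw [div_le_one (by linarith)]
    linarith
  have := isProbabilityMeasure_hardPi (n := k ^ 2) (K := k) (W := W) h0 h1
  have hsq : 2 ≤ √(k : ℝ) := Real.le_sqrt_of_sq_le (by linarith)
  have hss : √(k : ℝ) ^ 2 = k := Real.sq_sqrt (by linarith)
  simp only [lowPrices, shortfall, Set.mem_ofPred_eq] at hp
  set g := (unitLaw (k : ℝ)).real (above p)
  set m : ℝ := ((k ^ 2 : ℕ) : ℝ) * (bulkLaw (k : ℝ) ((1 + 2 * r) / k)).real (above p) with hm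
  -- `shortfall` is chosen so that `(1 + 2 * r) * (k - shortfall k r)` equals `k + 2 * √k` plus
  -- nonnegative terms, two standard deviations of slack for Chebyshev.
  have hmk : k + 2 * √k ≤ m := by
    have e1 : (1 + 2 * r) / k * g ≤ (bulkLaw (k : ℝ) ((1 + 2 * r) / k)).real (above p) := by
      rw [bulkLaw_real h0 h1]
      have : 0 ≤ (1 - (1 + 2 * r) / k) * (unitLaw 0).real (above p) :=
        mul_nonneg (by linarith) measureReal_nonneg
      linarith
    have e2 : (k : ℝ) ^ 2 * ((1 + 2 * r) / k * g) ≤ m := by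
      rw [hm]
      push_cast
      gcongr
    have e3 : (k : ℝ) ^ 2 * ((1 + 2 * r) / k * g) = (1 + 2 * r) * (k * g) := by field_simp
    have e4 : (1 + 2 * r) * ((k : ℝ) - (2 * k * r - 4 * k * r ^ 2 - 2 * √k)) ≤
        (1 + 2 * r) * (k * g) := by gcongr
    have e5 : 0 ≤ k * r ^ 3 := by positivity
    have e6 : 0 ≤ r * √k := by positivity
    nlinarith
  set t := m - k with ht
  have ht0 : 0 < t := by linarith
  have hcheb := chebyshev_countIn (n := k ^ 2) (K := k) (W := W) h0 h1 (measurableSet_above p) ht0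
  rw [← hm] at hcheb
  have hE : MeasurableSet {x : Fin (k ^ 2 + 1) → ℝ | k ≤ countIn (above p) x} := by
    have := measurableSet_le (measurable_const (a := (k : ℝ)))
      (measurable_countIn (n := k ^ 2) (measurableSet_above p))
    simpa using this
  have hcompl : (hardPi (k ^ 2) k W ((1 + 2 * r) / k)).real
      {x | k ≤ countIn (above p) x}ᶜ ≤ m / t ^ 2 := by
    refine (measureReal_mono fun x hx => ?_).trans hcheb
    simp only [Set.mem_compl_iff, Set.mem_ofPred_eq, not_le] at hx ⊢
    have hx' : (countIn (above p) x : ℝ) < k := by exact_mod_cast hx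
    rw [le_abs]
    right
    linarith
  -- With `m = k + t` and `t ≥ 2 * √k ≥ 4`, the quotient is at most `1 / 4 + 1 / 4`.
  have hle : m / t ^ 2 ≤ 1 / 2 := by
    rw [div_le_div_iff₀ (by positivity) (by norm_num)]
    have : m = k + t := by rw [ht]; ring
    nlinarith
  rw [probReal_compl_eq_one_sub hE] at hcompl
  linarith

lemma prob_sold_out (hk : 4 ≤ k) (hr : 0 < r) (hr' : r ≤ 1 / 4) (hC : 0 < C) (hCk : C * √k ≤ k)
    {p : EReal} (hp : p ∈ lowPrices k k (shortfall k r)) :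
    tiltFactor k r C * (1 / 2 - 2 / C ^ 2) ≤
      (hardPi (k ^ 2) k W ((1 + r) / k)).real {x | k ≤ countIn (above p) x} := by
  have hE : MeasurableSet {x : Fin (k ^ 2 + 1) → ℝ | k ≤ countIn (above p) x} := by
    have := measurableSet_le (measurable_const (a := (k : ℝ)))
      (measurable_countIn (n := k ^ 2) (measurableSet_above p))
    simpa using this
  have h := tilt_down (W := W) hk hr hr' hC hCk (f := {x : Fin (k ^ 2 + 1) → ℝ |
    k ≤ countIn (above p) x}.indicator fun _ => (1 : ℝ)) (measurable_const.indicator hE)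
    (fun x => Set.indicator_nonneg (fun _ _ => zero_le_one) x)
    (fun x => Set.indicator_le_self' (fun _ _ => zero_le_one) x)
  rw [integral_indicator_const _ hE, integral_indicator_const _ hE, smul_eq_mul, smul_eq_mul,
    mul_one, mul_one] at h
  refine le_trans (mul_le_mul_of_nonneg_left ?_ (Real.exp_pos _).le) h
  linarith [prob_sold_out_scaled (W := W) hk hr hr' hp]

/-- A competitive strategy cannot do well on both hard instances: if `h` is the probability of a
low price on the first one, then `1 - h` is bounded by the loss allowed there, and `h` by the loss
allowed on the second one. -/
theorem exists_low_price_prob (A : StaticPricingStrategy) {V τ : ℝ} (hk : 4 ≤ k) (hr : 0 < r)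
    (hr' : r ≤ 1 / 4) (hC : 2 ≤ C) (hCk : C * √k ≤ k) (hδ : 0 ≤ shortfall k r) (hV : 0 ≤ V)
    (hτ : 0 ≤ τ) (hτ' : τ ≤ 1) (hA : A.IsCompetitive k (1 - τ)) :
    ∃ h : ℝ, shortfall k r * (1 - h) ≤ 3 + 2 * √k + τ * (V + k) ∧
      V * (tiltFactor k r C * (1 / 2 - 2 / C ^ 2) * (tiltFactor k r C * (h - 2 / C ^ 2))) ≤
        3 + 2 * √k + τ * (V + k) := by
  have hk' : (4 : ℝ) ≤ k := by exact_mod_cast hk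
  have hk0 : (0 : ℝ) < k := by linarith
  have := A.isMarkovKernel (k ^ 2 + 1)
  have h0 : (0 : ℝ) ≤ 1 / k := by positivity
  have h1 : (1 / k : ℝ) ≤ 1 := by
    rw [div_le_one (by linarith)]
    linarith
  have h0' : (0 : ℝ) ≤ (1 + r) / k := by positivity
  have h1' : ((1 + r) / k : ℝ) ≤ 1 := by
    rw [div_le_one (by linarith)]
    linarith
  have hn : k ≤ k ^ 2 + 1 := by nlinarith
  have hW : 0 ≤ k * V := by positivity
  have hm : ((k ^ 2 : ℕ) : ℝ) * (1 / k) = k := by push_cast; field_simp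
  have hm' : ((k ^ 2 : ℕ) : ℝ) * ((1 + r) / k) = k * (1 + r) := by push_cast; field_simp
  have hsq : 0 ≤ √(k : ℝ) := Real.sqrt_nonneg _
  set S := lowPrices k k (shortfall k r) with hS
  have hSm : MeasurableSet S := measurableSet_lowPrices _ _ _
  have := isProbabilityMeasure_hardPi (n := k ^ 2) (K := k) (W := k * V) h0 h1
  have hκm : ∀ T : Set EReal, MeasurableSet T → Measurable fun y => (A.price (k ^ 2 + 1) y).real T :=
    fun T hT => (Kernel.measurable_coe _ hT).ennreal_toReal
  -- Both instances end in this comparison, in units of `k`: the unit widths of the value intervals,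
  -- the reserved item and the fluctuations account for `3 + 2 * √k`.
  have hred : ∀ L x : ℝ, ((k : ℝ) * V + k * (k - 1 - 2 * √k)) ≤ x →
      (1 - τ) * x ≤ ((k : ℝ) + 1) * k + (k * V + 1) - k * L → L ≤ 3 + 2 * √k + τ * (V + k) := by
    intro L x hx hle
    have e1 := (mul_le_mul_of_nonneg_left hx (by linarith : 0 ≤ 1 - τ)).trans hle
    have e2 : (k : ℝ) * L ≤ k * (3 + 2 * √k + τ * (V + k)) := by
      have : 0 ≤ τ * (k * (1 + 2 * √k)) := by positivity
      nlinarith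
    exact le_of_mul_le_mul_left e2 hk0
  -- `h` is the probability of a low price under samples from the first instance; `tilt_up`
  -- transfers it to the second.
  refine ⟨∫ y, (A.price (k ^ 2 + 1) y).real S ∂(hardPi (k ^ 2) k (k * V) (1 / k)), ?_, ?_⟩
  · have hopt := le_integral_prophetValue (n := k ^ 2) (K := k) (W := k * V) hk hn (by linarith)
      hW h0 h1 hm.ge (by linarith)
    have halg := integral_algValue_le (n := k ^ 2) (k := k) (K := k) (W := k * V) A hk0.le hW h0 h1
      hSm.compl (loss := (k + 1) * shortfall k r) fun p hp =>
        integral_revenueBound_le_of_notMem hk hδ hW hp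
    have hcomp := hA (k ^ 2 + 1) hn (hardLaw (k ^ 2) k (k * V) (1 / k))
      (isValuationLaw_hardLaw hk0.le hW h0 h1)
    have hcompl : ∫ y, (A.price (k ^ 2 + 1) y).real Sᶜ ∂(hardPi (k ^ 2) k (k * V) (1 / k)) =
        1 - ∫ y, (A.price (k ^ 2 + 1) y).real S ∂(hardPi (k ^ 2) k (k * V) (1 / k)) := by
      simp_rw [probReal_compl_eq_one_sub hSm]
      rw [integral_sub (integrable_const _)]
      · rw [integral_const, probReal_univ, one_smul]
      · refine Integrable.of_bound (hκm S hSm).aestronglyMeasurable 1 (ae_of_all _ fun y => ?_)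
        rw [Real.norm_eq_abs, abs_of_nonneg measureReal_nonneg]
        exact measureReal_le_one
    have hnn : 0 ≤ ∫ y, (A.price (k ^ 2 + 1) y).real Sᶜ ∂(hardPi (k ^ 2) k (k * V) (1 / k)) :=
      integral_nonneg fun y => measureReal_nonneg
    rw [← hcompl]
    refine hred _ _ hopt (hcomp.trans (halg.trans ?_))
    nlinarith [mul_nonneg hδ hnn]
  · have hopt := le_integral_prophetValue (n := k ^ 2) (K := k) (W := k * V) hk hn (by linarith)
      hW h0' h1' (by rw [hm']; nlinarith) (by rw [hm']; nlinarith)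
    have halg := integral_algValue_le (n := k ^ 2) (k := k) (K := k) (W := k * V) A hk0.le hW h0' h1'
      hSm (loss := (k * V + 1) * (tiltFactor k r C * (1 / 2 - 2 / C ^ 2))) fun p hp =>
        integral_revenueBound_le_of_prob hk0.le hW h0' h1'
          (prob_sold_out hk hr hr' (by linarith) hCk hp)
    have hcomp := hA (k ^ 2 + 1) hn (hardLaw (k ^ 2) k (k * V) ((1 + r) / k))
      (isValuationLaw_hardLaw hk0.le hW h0' h1')
    have htilt := tilt_up (W := k * V) hk hr hr' (by linarith : 0 < C) (hκm S hSm)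
      (fun y => measureReal_nonneg) (fun y => measureReal_le_one)
    have hnn : 0 ≤ ∫ y, (A.price (k ^ 2 + 1) y).real S ∂(hardPi (k ^ 2) k (k * V) ((1 + r) / k)) :=
      integral_nonneg fun y => measureReal_nonneg
    have hhalf : 0 ≤ 1 / 2 - 2 / C ^ 2 := by
      rw [sub_nonneg, div_le_div_iff₀ (by positivity) (by norm_num)]
      nlinarith
    have hq : 0 ≤ tiltFactor k r C * (1 / 2 - 2 / C ^ 2) := mul_nonneg (Real.exp_pos _).le hhalf
    refine le_trans (mul_le_mul_of_nonneg_left (mul_le_mul_of_nonneg_left htilt hq) hV) ?_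
    refine hred _ _ hopt (hcomp.trans (halg.trans ?_))
    nlinarith [mul_nonneg hq hnn]

end LowerBound

/-! ### Choice of parameters and passage to the limit -/

section Asymptotic

lemma tendsto_sqrt_log_natCast :
    Tendsto (fun k : ℕ => √(Real.log k)) atTop atTop :=
  Real.tendsto_sqrt_atTop.comp (Real.tendsto_log_atTop.comp tendsto_natCast_atTop_atTop)

lemma eventually_two_mul_log_le_sqrt : ∀ᶠ k : ℕ in atTop, 2 * Real.log k ≤ √(k : ℝ) := by
  have h := (isLittleO_log_rpow_atTop (r := 1 / 2) (by norm_num)).comp_tendsto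
    (tendsto_natCast_atTop_atTop (R := ℝ))
  have h2 := h.bound (c := 1 / 2) (by norm_num)
  filter_upwards [h2] with k hk
  simp only [Function.comp, Real.norm_eq_abs, ← Real.sqrt_eq_rpow,
    abs_of_nonneg (Real.sqrt_nonneg _)] at hk
  linarith [le_abs_self (Real.log k)]

/-- The exponential gain beats the linear loss. -/
lemma eventually_lt_exp_quadratic {e M γ a : ℝ} (he : 0 < e) (hγ : 0 < γ) :
    ∀ᶠ L : ℝ in atTop, 5 + a * L < γ * Real.exp (e * L ^ 2 - M * L - 2) := by
  filter_upwards [eventually_ge_atTop 1, eventually_ge_atTop ((|M| + 3) / e),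
    eventually_gt_atTop ((5 + |a|) * 2 / γ)] with L h1 h2 h3
  have hM := le_abs_self M
  have ha := le_abs_self a
  have h4 : L ≤ e * L ^ 2 - M * L - 2 := by
    rw [div_le_iff₀ he] at h2
    nlinarith
  have h5 : L ^ 2 / 2 < Real.exp (e * L ^ 2 - M * L - 2) := by
    have := Real.quadratic_le_exp_of_nonneg (by linarith : 0 ≤ L)
    have := Real.exp_le_exp.2 h4
    linarith
  rw [div_lt_iff₀ hγ] at h3
  calc 5 + a * L ≤ (5 + |a|) * L := by nlinarith
    _ ≤ (L * γ) / 2 * L := by gcongr; linarith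
    _ = γ * (L ^ 2 / 2) := by ring
    _ < _ := by gcongr

-- With `L = √(log k)` and `q = √k`, all losses are `q` times functions of `L`. Either `h ≤ γ`, and
-- the first instance compares `2 * b * (1 - γ) * L` with `a * L` up to constants; or `h > γ`, and
-- the second compares `exp (ε / 16 * L ^ 2 - O(L))` with `O(L)`.
set_option maxHeartbeats 400000 in
theorem eventually_not_isCompetitive {ε : ℝ} (hε : 0 < ε) (hε2 : ε ≤ 2) :
    ∀ᶠ k : ℕ in atTop, ∀ A : StaticPricingStrategy,
      ¬ A.IsCompetitive k (1 - √((2 - ε) * Real.log k / k)) := by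
  set β : ℝ := 1 / 2 - ε / 8 with hβ
  set a : ℝ := √(2 - ε) with ha
  set b : ℝ := √β with hb
  have hβ0 : 1 / 4 ≤ β := by linarith
  have ha0 : 0 ≤ a := Real.sqrt_nonneg _
  have ha2 : a ^ 2 = 2 - ε := Real.sq_sqrt (by linarith)
  have hb2 : b ^ 2 = β := Real.sq_sqrt (by linarith)
  have hb0 : 1 / 2 ≤ b := Real.le_sqrt_of_sq_le (by linarith)
  have hab : a < 2 * b := by
    refine lt_of_pow_lt_pow_left₀ 2 (by linarith) ?_
    rw [mul_pow, ha2, hb2]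
    linarith
  -- Half the slack in `a < 2 * b`: the first instance still fails when `h ≤ γ`.
  set γ : ℝ := (1 - a / (2 * b)) / 2 with hγ
  have hγ0 : 0 < γ := by
    have : a / (2 * b) < 1 := by rw [div_lt_one (by linarith)]; exact hab
    linarith
  have hγ1 : γ ≤ 1 / 2 := by
    have : 0 ≤ a / (2 * b) := by positivity
    linarith
  have hgap : 0 < 2 * b * (1 - γ) - a := by
    have : 2 * b * (1 - γ) = b + a / 2 := by
      rw [hγ]
      field_simp
      ring
    linarith
  -- Makes the atypical mass `2 / C ^ 2` small compared with `γ`.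
  set C : ℝ := 4 / γ with hC
  have hC8 : 8 ≤ C := by
    rw [hC, le_div_iff₀ hγ0]
    linarith
  have hCsq : 2 / C ^ 2 = γ ^ 2 / 8 := by
    rw [hC]
    field_simp
    norm_num
  have hexp := eventually_lt_exp_quadratic (e := ε / 16) (M := 2 * C * b) (γ := γ / 8)
    (a := 2 * a) (by linarith) (by linarith)
  filter_upwards [eventually_ge_atTop 16, eventually_two_mul_log_le_sqrt,
    tendsto_sqrt_log_natCast.eventually hexp,
    tendsto_sqrt_log_natCast.eventually (eventually_ge_atTop 3),
    tendsto_sqrt_log_natCast.eventually (eventually_ge_atTop (16 / ε)),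
    tendsto_sqrt_log_natCast.eventually
      (eventually_gt_atTop ((8 + a) / (2 * b * (1 - γ) - a))),
    (Real.tendsto_sqrt_atTop.comp tendsto_natCast_atTop_atTop).eventually
      (eventually_ge_atTop C)] with k hk16 hlog hexp hL3 hLε hLgap hkC A hA
  set L : ℝ := √(Real.log k) with hL
  have hk : (16 : ℝ) ≤ k := by exact_mod_cast hk16
  have hk0 : (0 : ℝ) < k := by linarith
  have hlog0 : 0 ≤ Real.log k := Real.log_nonneg (by linarith)
  have hL2 : L ^ 2 = Real.log k := Real.sq_sqrt hlog0
  set q : ℝ := √(k : ℝ) with hq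
  have hq2 : q ^ 2 = k := Real.sq_sqrt hk0.le
  have hq4 : 4 ≤ q := Real.le_sqrt_of_sq_le (by linarith)
  have hqexp : q = Real.exp (L ^ 2 / 2) := by
    rw [hL2, hq, Real.sqrt_eq_iff_mul_self_eq hk0.le (Real.exp_pos _).le, ← Real.exp_add,
      add_halves, Real.exp_log hk0]
  have hkC' : C ≤ q := hkC
  set r : ℝ := b * L / q with hr
  have hr0 : 0 < r := by positivity
  have hqr : q * r = b * L := by rw [hr]; field_simp
  have hkr : k * r ^ 2 = β * L ^ 2 := by rw [← hq2, ← mul_pow, hqr, mul_pow, hb2]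
  have hβL : β * L ^ 2 = L ^ 2 / 2 - ε / 8 * L ^ 2 := by rw [hβ]; ring
  have hβL' : β * L ^ 2 ≤ 1 / 2 * L ^ 2 :=
    mul_le_mul_of_nonneg_right (by linarith) (sq_nonneg L)
  have hLq : 2 * L ^ 2 ≤ q := by rw [hL2]; exact hlog
  have hr4 : r ≤ 1 / 4 := by
    refine le_of_pow_le_pow_left₀ two_ne_zero (by norm_num) ?_
    have h1 : k * r ^ 2 ≤ k * (1 / 4) ^ 2 := by
      rw [hkr, ← hq2]
      have h2 : q * 4 ≤ q * q := mul_le_mul_of_nonneg_left hq4 (by linarith)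
      linarith
    exact le_of_mul_le_mul_left h1 hk0
  clear_value r
  set τ : ℝ := √((2 - ε) * Real.log k / k) with hτ
  have hτq : τ = a * L / q := by
    rw [hτ, Real.sqrt_div' _ hk0.le, Real.sqrt_mul (by linarith)]
  have hτ0 : 0 ≤ τ := Real.sqrt_nonneg _
  have hτ1 : τ ≤ 1 := by
    rw [hτ, Real.sqrt_le_one, div_le_one hk0, ← hL2]
    have h1 : (2 - ε) * L ^ 2 ≤ 2 * L ^ 2 :=
      mul_le_mul_of_nonneg_right (by linarith) (sq_nonneg L)
    have h2 : q * 1 ≤ q * q := mul_le_mul_of_nonneg_left (by linarith) (by linarith)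
    linarith
  have hτk : τ * k = q * (a * L) := by
    rw [hτq, ← hq2]
    field_simp
  have hS : shortfall k r = q * (2 * (b * L) - 2) - 4 * (β * L ^ 2) := by
    rw [shortfall, ← hqr, ← hkr, ← hq, ← hq2]
    ring
  have hSge : q * (2 * (b * L) - 3) ≤ shortfall k r := by
    rw [hS]
    linarith
  have hbL : 3 / 2 ≤ b * L := by
    have : 1 / 2 * 3 ≤ b * L := mul_le_mul hb0 hL3 (by norm_num) (by linarith)
    linarith
  -- `d = k ^ (-ε / 16)` is small enough that `L * d ≤ 1`, so the last buyer hardly adds to the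
  -- allowed loss, and costs only half of the exponent `ε / 8 * L ^ 2` gained from `β < 1 / 2`.
  set d : ℝ := Real.exp (-(ε / 16 * L ^ 2)) with hd
  have hd0 : 0 < d := Real.exp_pos _
  have hd1 : d ≤ 1 := Real.exp_le_one_iff.2 (by
    have : 0 ≤ ε / 16 * L ^ 2 := by positivity
    linarith)
  have hLd : L * d ≤ 1 := by
    have h1 : L ≤ Real.exp (ε / 16 * L ^ 2) := by
      have := Real.add_one_le_exp (ε / 16 * L ^ 2)
      rw [div_le_iff₀ hε] at hLε
      have := mul_le_mul_of_nonneg_left hLε (by linarith : 0 ≤ L)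
      linarith
    rw [hd, Real.exp_neg, ← div_eq_mul_inv, div_le_one (Real.exp_pos _)]
    exact h1
  clear_value a b γ C L q τ d β
  obtain ⟨h, h1, h2⟩ := exists_low_price_prob (C := C) (V := k * d) (τ := τ) A (by omega) hr0 hr4
    (by linarith) (by
      rw [← hq, ← hq2, pow_two]
      exact mul_le_mul_of_nonneg_right hkC' (by linarith)) (le_trans (by
      have : 0 ≤ 2 * (b * L) - 3 := by linarith
      positivity) hSge) (by positivity) hτ0 hτ1 hA
  rw [← hq] at h1 h2
  have hbound : 3 + 2 * q + τ * (k * d + k) ≤ q * (3 + a * L * (1 + d)) := by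
    have : τ * (k * d + k) = q * (a * L) * (1 + d) := by rw [← hτk]; ring
    rw [this]
    linarith
  have hq0 : 0 < q := by linarith
  rcases le_or_gt h γ with hh | hh
  · have e1 : q * ((2 * (b * L) - 3) * (1 - γ)) ≤ q * (3 + a * L * (1 + d)) := by
      refine le_trans ?_ (h1.trans hbound)
      rw [← mul_assoc]
      refine mul_le_mul hSge (by linarith) (by linarith) (le_trans ?_ hSge)
      have : 0 ≤ 2 * (b * L) - 3 := by linarith
      positivity
    have e2 := le_of_mul_le_mul_left e1 hq0
    rw [div_lt_iff₀ hgap] at hLgap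
    have e3 : a * (L * d) ≤ a * 1 := by gcongr
    linarith
  · have hT : tiltFactor k r C * tiltFactor k r C =
        Real.exp (-(β * L ^ 2 + 2 * C * b * L + 8 * r)) := by
      rw [tiltFactor, ← Real.exp_add, ← hq]
      congr 1
      have : C * q * r = C * (b * L) := by rw [mul_assoc, hqr]
      rw [this, hkr]
      ring
    have e1 : γ / 8 * (k * d * (tiltFactor k r C * tiltFactor k r C)) ≤
        q * (3 + a * L * (1 + d)) := by
      refine le_trans ?_ (h2.trans hbound)
      rw [hCsq]
      have t0 : 0 < tiltFactor k r C := Real.exp_pos _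
      have g0 : γ ^ 2 ≤ 1 / 2 * γ := by
        rw [pow_two]
        exact mul_le_mul_of_nonneg_right hγ1 hγ0.le
      have g1 : 1 / 4 ≤ 1 / 2 - γ ^ 2 / 8 := by linarith
      have g2 : γ / 2 ≤ h - γ ^ 2 / 8 := by linarith
      have g3 : 1 / 4 * (γ / 2) ≤ (1 / 2 - γ ^ 2 / 8) * (h - γ ^ 2 / 8) :=
        mul_le_mul g1 g2 (by linarith) (by linarith)
      have g4 : 0 ≤ k * d * (tiltFactor k r C * tiltFactor k r C) := by positivity
      linarith [mul_le_mul_of_nonneg_left g3 g4]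
    have e2 : q * Real.exp (ε / 16 * L ^ 2 - 2 * C * b * L - 2) ≤
        k * d * (tiltFactor k r C * tiltFactor k r C) := by
      rw [hT, hd, mul_assoc (k : ℝ), ← Real.exp_add, ← hq2, pow_two q, mul_assoc q q]
      refine mul_le_mul_of_nonneg_left ?_ hq0.le
      nth_rewrite 1 [hqexp]
      rw [← Real.exp_add, Real.exp_le_exp]
      linarith
    have e3 : q * (γ / 8 * Real.exp (ε / 16 * L ^ 2 - 2 * C * b * L - 2)) ≤
        q * (3 + a * L * (1 + d)) := by
      refine le_trans (le_of_eq_of_le (by ring) (mul_le_mul_of_nonneg_left e2 ?_)) e1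
      positivity
    have e4 := le_of_mul_le_mul_left e3 hq0
    have e5 : a * L * (1 + d) ≤ a * L * 2 := by gcongr; linarith
    linarith

lemma isCompetitive_mono {A : StaticPricingStrategy} {k : ℕ} {c c' : ℝ} (h : A.IsCompetitive k c)
    (hc : c' ≤ c) : A.IsCompetitive k c' := by
  intro n hn D hD
  refine le_trans (mul_le_mul_of_nonneg_right hc ?_) (h n hn D hD)
  have := fun i => (hD i).isProbabilityMeasure
  refine integral_nonneg_of_ae ?_
  have hae : ∀ᵐ x ∂(Measure.pi D), ∀ i, 0 ≤ x i := by
    rw [eventually_all]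
    intro i
    refine (Measure.tendsto_eval_ae_ae (μ := D) (i := i)).eventually (p := fun t => 0 ≤ t) ?_
    filter_upwards [measure_eq_zero_iff_ae_notMem.1 (hD i).nonneg] with t ht
    simpa using ht
  filter_upwards [hae] with x hx
  simpa using sum_le_prophetValue_of_nonneg hn hx (S := ∅) (by simp)

/-- A crude bound for every `k ≥ 1`, needed so that the supremum defining the error term is over a
bounded set. -/
lemma le_of_isCompetitive {A : StaticPricingStrategy} {k : ℕ} {c : ℝ} (hk : 1 ≤ k)
    (h : A.IsCompetitive k c) : c ≤ 2 * k + 2 := by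
  rcases le_or_gt c 0 with hc | hc
  · exact hc.trans (by positivity)
  have hD := isValuationLaw_hardLaw (n := k) (K := 1) (W := 1) (s := 0) zero_le_one zero_le_one
    le_rfl zero_le_one
  have := isProbabilityMeasure_hardPi (n := k) (K := 1) (W := 1) (s := 0) le_rfl zero_le_one
  have h1 := h (k + 1) (by omega) _ hD
  have h2 := integral_algValue_le (n := k) (k := k) (K := 1) (W := 1) (s := 0) A zero_le_one
    zero_le_one le_rfl zero_le_one MeasurableSet.empty (loss := 0) (by simp)
  have h3 : 1 ≤ ∫ x, prophetValue k x ∂(hardPi k 1 1 0) := by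
    calc (1 : ℝ) = ∫ x, (1 : ℝ) ∂(hardPi k 1 1 0) := by
          rw [integral_const, probReal_univ, one_smul]
      _ ≤ _ := by
        refine integral_mono_ae (integrable_const _) (integrable_prophetValue (by omega) _ hD) ?_
        filter_upwards [ae_hardPi (n := k) (K := 1) (W := 1) (s := 0) zero_le_one le_rfl
          zero_le_one] with x hx
        have hx0 : ∀ i, 0 ≤ x i := by
          intro i
          induction i using Fin.lastCases with
          | last => linarith [hx.2.1]
          | cast i => exact (hx.1 i).1
        refine hx.2.1.trans ?_
        simpa using sum_le_prophetValue_of_nonneg (k := k) (by omega) hx0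
          (S := {Fin.last k}) (by simpa using hk)
  nlinarith

end Asymptotic

theorem theorem3 :
    (∀ ε : ℝ, 0 < ε → ε ≤ 2 → ∀ᶠ k : ℕ in atTop, ∀ A : StaticPricingStrategy,
      ¬ A.IsCompetitive k (1 - Real.sqrt ((2 - ε) * Real.log k / k))) ∧
    (∃ δ : ℕ → ℝ,
      δ =o[atTop] (fun k : ℕ => Real.sqrt (Real.log k / k)) ∧
      ∀ k : ℕ, 1 ≤ k → ∀ (A : StaticPricingStrategy) (c : ℝ), A.IsCompetitive k c →
        c ≤ 1 - Real.sqrt (2 * Real.log k / k) + δ k) := by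
  refine ⟨fun ε h0 h2 => eventually_not_isCompetitive h0 h2, ?_⟩
  -- The error term is the largest excess over the target ratio; inserting 0 makes the set nonempty
  -- and, where it is bounded, its supremum nonnegative.
  set S : ℕ → Set ℝ := fun k => insert 0 {t | ∃ (A : StaticPricingStrategy) (c : ℝ),
    A.IsCompetitive k c ∧ t = c - (1 - √(2 * Real.log k / k))} with hS
  refine ⟨fun k => sSup (S k), ?_, ?_⟩
  · rw [isLittleO_iff]
    intro η hη
    -- Chosen so that `√2 - √(2 - ε) ≤ η`.
    set ε : ℝ := min 2 (η ^ 2) with hε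
    have hε0 : 0 < ε := lt_min two_pos (by positivity)
    have hε2 : ε ≤ 2 := min_le_left _ _
    have hsqrt : √2 ≤ √(2 - ε) + η := by
      refine Real.sqrt_le_iff.2 ⟨by positivity, ?_⟩
      have h1 : √(2 - ε) ^ 2 = 2 - ε := Real.sq_sqrt (by linarith)
      have h2 : ε ≤ η ^ 2 := min_le_right _ _
      nlinarith [mul_nonneg (Real.sqrt_nonneg (2 - ε)) hη.le]
    filter_upwards [eventually_not_isCompetitive hε0 hε2] with k hk
    have hsplit : ∀ a : ℝ, 0 ≤ a → √(a * Real.log k / k) = √a * √(Real.log k / k) :=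
      fun a ha => by rw [mul_div_assoc, Real.sqrt_mul ha]
    have hg : 0 ≤ √(Real.log k / k) := Real.sqrt_nonneg _
    have hub : ∀ t ∈ S k, t ≤ η * √(Real.log k / k) := by
      rintro t (rfl | ⟨A, c, hA, rfl⟩)
      · positivity
      · have hc : c ≤ 1 - √((2 - ε) * Real.log k / k) := by
          by_contra! hlt
          exact hk A (isCompetitive_mono hA hlt.le)
        rw [hsplit _ (by linarith)] at hc
        rw [hsplit _ (by norm_num)]
        nlinarith
    have hnn : 0 ≤ sSup (S k) := le_csSup ⟨_, hub⟩ (Set.mem_insert _ _)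
    rw [Real.norm_eq_abs, Real.norm_eq_abs, abs_of_nonneg hnn, abs_of_nonneg hg]
    exact csSup_le ⟨0, Set.mem_insert _ _⟩ hub
  · intro k hk A c hA
    have hbdd : BddAbove (S k) := by
      refine ⟨2 * k + 2 + √(2 * Real.log k / k), ?_⟩
      rintro t (rfl | ⟨A, c, hA, rfl⟩)
      · positivity
      · linarith [le_of_isCompetitive hk hA]
    have := le_csSup hbdd (Set.mem_insert_of_mem 0 ⟨A, c, hA, rfl⟩ :
      c - (1 - √(2 * Real.log k / k)) ∈ S k)
    linarith
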